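/- Let $(M,g)$ be a connected smooth Riemannian manifold (not necessarily compact), and let $\mathcal E\to M$ be a smooth real vector bundle of finite rank with a smooth fibre metric $\langle\,,\rangle$ and a smooth connection $\nabla$ compatible with $\langle\,,\rangle$. For $p,q\in\mathbb R$, a smooth section $\sigma$ of $\mathcal E$ and a compact set $K\subset M$, define the vertical $(p,q)$-energy $$E^v_{p,q}(\sigma;K)=\frac12\int_K \frac{1}{(1+|\sigma|^2)^{p}}\sum_i\Bigl(\langle\nabla_{E_i}\sigma,\nabla_{E_i}\sigma\rangle+q\,\langle\nabla_{E_i}\sigma,\sigma\rangle^2\Bigr)\operatorname{vol}(g),$$ where $(E_i)$ is an orthonormal basis of the tangent space at each point. The section $\sigma$ is called $(p,q)$-harmonic if, for every compact $K\subset M$ and every smooth variation $(\sigma_t)_{t\in\mathbb R}$ of $\sigma=\sigma_0$ through sections of $\mathcal E$ with $\sigma_t=\sigma$ outside $K$ for all $t$, one has $\frac{d}{dt}\big|_{t=0}E^v_{p,q}(\sigma_t;K)=0$. Suppose $\sigma$ is a smooth section of $\mathcal E$ for which $|\sigma|^2\colon M\to\mathbb R$ is a non-constant harmonic function (that is, $\Delta|\sigma|^2=0$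 for the Laplace-Beltrami operator $\Delta$ of $g$). Then for each $p\in\mathbb R$ there exists at most one $q\in\mathbb R$ such that $\sigma$ is $(p,q)$-harmonic. Moreover, whenever $\sigma$ is $(p,q)$-harmonic: (a) if $p<0$ and $q\le 4p$, then $|\sigma(x)|^2>-2/q$ for some $x\in M$; (b) if $0\le p\le 1$, then $q<0$ and $|\sigma(x)|^2>-2/q$ for some $x\in M$; (c) if $p>1$ and $q<2(1-p)$, then $|\sigma(x)|^2>-2/q$ for some $x\in M$; (d) if $p>1$ and $q\ge 2(1-p)$, then $|\sigma(x)|^2>1/(p-1)$ for some $x\in M$. -/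

import Mathlib

open Bundle MeasureTheory Set
open scoped Manifold ContDiff ENNReal

noncomputable section

namespace HarmonicSections

/-! ### Riemannian geometry in charts -/

section Manifold

variable {n : ℕ} {M : Type*} [TopologicalSpace M] [ChartedSpace (EuclideanSpace ℝ (Fin n)) M]

/-- The coordinate vector `∂ᵢ` of the chart `e`, at the point with coordinates `y`. -/
def coordVector (e : OpenPartialHomeomorph M (EuclideanSpace ℝ (Fin n)))
    (y : EuclideanSpace ℝ (Fin n)) (i : Fin n) : TangentSpace (𝓡 n) (e.symm y) :=
  mfderiv (𝓡 n) (𝓡 n) e.symm y (EuclideanSpace.single i (1 : ℝ))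

variable [RiemannianBundle (fun x : M ↦ TangentSpace (𝓡 n) x)]

/-- The matrix `gᵢⱼ = g(∂ᵢ, ∂ⱼ)` of the Riemannian metric in the chart `e`, as a function of the
coordinates. -/
def metricMatrix (e : OpenPartialHomeomorph M (EuclideanSpace ℝ (Fin n)))
    (y : EuclideanSpace ℝ (Fin n)) : Matrix (Fin n) (Fin n) ℝ :=
  Matrix.of fun i j ↦ inner ℝ (coordVector e y i) (coordVector e y j)

/-- `√(det gᵢⱼ)` in the chart `e`. -/
def volumeDensity (e : OpenPartialHomeomorph M (EuclideanSpace ℝ (Fin n)))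
    (y : EuclideanSpace ℝ (Fin n)) : ℝ :=
  √(metricMatrix e y).det

/-- The Riemannian measure of the domain of the chart `e`, viewed as a measure on `M`: the image
under `e⁻¹` of the measure `√(det gᵢⱼ) dy¹ ⋯ dyⁿ` on the range of `e`. -/
def chartVolume [MeasurableSpace M] (e : OpenPartialHomeomorph M (EuclideanSpace ℝ (Fin n))) :
    Measure M :=
  (((volume : Measure (EuclideanSpace ℝ (Fin n))).restrict e.target).withDensity
    (fun y ↦ ENNReal.ofReal (volumeDensity e y))).map e.symm

variable (n M) in
/-- The Riemannian measure `vol(g)` of `M`. The measures of the chart domains agree on overlaps, so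
their least upper bound is the measure whose restriction to the domain of each chart `e` is
`chartVolume e`. -/
def riemannianVolume [MeasurableSpace M] : Measure M :=
  ⨆ e ∈ IsManifold.maximalAtlas (𝓡 n) ∞ M, chartVolume e

/-- The Laplace-Beltrami operator, `Δu = -(det g)^(-1/2) ∑ᵢ ∂ᵢ ((det g)^(1/2) ∑ⱼ gⁱʲ ∂ⱼu)`,
in the chart `e`, at the point with coordinates `y`. -/
def laplacianInChart (e : OpenPartialHomeomorph M (EuclideanSpace ℝ (Fin n))) (u : M → ℝ)
    (y : EuclideanSpace ℝ (Fin n)) : ℝ :=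
  -((volumeDensity e y)⁻¹ * ∑ i, fderiv ℝ (fun z ↦ volumeDensity e z *
      ∑ j, (metricMatrix e z)⁻¹ i j *
        fderiv ℝ (fun z' ↦ u (e.symm z')) z (EuclideanSpace.single j (1 : ℝ)))
    y (EuclideanSpace.single i (1 : ℝ)))

variable (n) in
/-- A smooth function `u` on `M` is harmonic if `Δu = 0`, in all charts of the smooth structure. -/
def IsHarmonicFunction (u : M → ℝ) : Prop :=
  ContMDiff (𝓡 n) 𝓘(ℝ, ℝ) ∞ u ∧
    ∀ e ∈ IsManifold.maximalAtlas (𝓡 n) ∞ M, ∀ y ∈ e.target, laplacianInChart e u y = 0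

end Manifold

/-! ### The vertical energy of sections -/

/-- The metric `h_{p,q}` on vertical vectors at the point `e` of a Euclidean fibre `W`:
`w(e)^p (⟨A, B⟩ + q ⟨A, e⟩ ⟨B, e⟩)`, where `w(e) = 1 / (1 + |e|²)`. -/
def verticalMetric {W : Type*} [NormedAddCommGroup W] [InnerProductSpace ℝ W]
    (p q : ℝ) (e A B : W) : ℝ :=
  (1 / (1 + ‖e‖ ^ 2)) ^ p * (inner ℝ A B + q * inner ℝ A e * inner ℝ B e)

instance {n : ℕ} {M : Type*} [TopologicalSpace M] [ChartedSpace (EuclideanSpace ℝ (Fin n)) M]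
    (x : M) : FiniteDimensional ℝ (TangentSpace (𝓡 n) x) :=
  inferInstanceAs (FiniteDimensional ℝ (EuclideanSpace ℝ (Fin n)))

section Bundle

variable {n : ℕ} {M : Type*} [TopologicalSpace M] [ChartedSpace (EuclideanSpace ℝ (Fin n)) M]
  [RiemannianBundle (fun x : M ↦ TangentSpace (𝓡 n) x)]
  {V : Type*} [NormedAddCommGroup V] [NormedSpace ℝ V]
  {E : M → Type*} [TopologicalSpace (TotalSpace V E)] [∀ x, NormedAddCommGroup (E x)]
  [∀ x, InnerProductSpace ℝ (E x)] [FiberBundle V E]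

/-- `|d^v σ|²` at `x`, with respect to `h_{p,q}`: the sum of `h_{p,q}(∇_{Eᵢ}σ, ∇_{Eᵢ}σ)` over an
orthonormal basis `(Eᵢ)` of `T_x M`. The sum does not depend on the basis. The connection map sends
the vertical part of `dσ(X)` to `∇_X σ`, which is `cov σ x X` here. -/
def verticalNormSq (cov : CovariantDerivative (𝓡 n) V E) (p q : ℝ) (σ : Π x, E x) (x : M) : ℝ :=
  ∑ i, verticalMetric p q (σ x)
    (cov σ x (stdOrthonormalBasis ℝ (TangentSpace (𝓡 n) x) i))
    (cov σ x (stdOrthonormalBasis ℝ (TangentSpace (𝓡 n) x) i))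

/-- The vertical `(p,q)`-energy of `σ` over `K`. -/
def verticalEnergy [MeasurableSpace M] (cov : CovariantDerivative (𝓡 n) V E) (p q : ℝ)
    (K : Set M) (σ : Π x, E x) : ℝ :=
  1 / 2 * ∫ x in K, verticalNormSq cov p q σ x ∂(riemannianVolume n M)

variable (n V) in
/-- `τ` is a smooth variation of the section `σ` through sections `τ t` of `E`, supported in `K`. -/
structure IsVariation (σ : Π x, E x) (K : Set M) (τ : ℝ → Π x, E x) : Prop where
  smooth : ContMDiff ((𝓡 n).prod 𝓘(ℝ, ℝ)) ((𝓡 n).prod 𝓘(ℝ, V)) ∞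
    (fun z : M × ℝ ↦ TotalSpace.mk' V z.1 (τ z.2 z.1))
  zero : τ 0 = σ
  eq_off : ∀ t, ∀ x ∉ K, τ t x = σ x

/-- `σ` is a `(p,q)`-harmonic section of `E`: it is stationary for the vertical `(p,q)`-energy over
every compact set `K`, with respect to all smooth variations supported in `K`. -/
def IsHarmonicSection [MeasurableSpace M] (cov : CovariantDerivative (𝓡 n) V E) (p q : ℝ)
    (σ : Π x, E x) : Prop :=
  ∀ K : Set M, IsCompact K → ∀ τ : ℝ → Π x, E x, IsVariation n V σ K τ →
    HasDerivAt (fun t ↦ verticalEnergy cov p q K (τ t)) 0 0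

end Bundle

end HarmonicSections

end

noncomputable section

set_option linter.unusedSectionVars false

namespace HarmonicSections

open scoped Topology

/-! ### Linear algebra -/

/-! Write U = |σ|², S = |∇σ|² and A = |dU|². Only the variations (1 + t f) σ are needed, with f
smooth and compactly supported in a chart: they extract the component of the Euler-Lagrange equation
along σ. Compatibility of ∇ with the fibre metric gives dU(X) = 2⟨∇_X σ, σ⟩, so the energy density
of (1 + t f) σ depends only on t, f, U, S, A, ⟨df, dU⟩ and |df|². Its derivative at t = 0 is ⟨d(f
ψ(U)), dU⟩, where ψ(U) = (1 + U)^(-p) (1 + qU), plus f (1 + U)^(-p-1) times 2(1 + (1 - p)U) S + p(1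
+ qU/2) A. The first term integrates to zero because U is harmonic; since f is arbitrary, the last
factor vanishes at every point (`IsHarmonicSection.pointwise_eq`).

The rest is algebra at a point where dU ≠ 0, which exists because U is not constant and M is
connected. Cauchy-Schwarz, A ≤ 4US (`gradInner_norm_sq_self_le`), makes U and S positive there. The
pointwise equation is affine in q with slope pUA/2, hence q is unique if p ≠ 0; if p = 0 the
equation reads 2(1 + U)S = 0 and no q is possible. Each lower bound holds because its failure would
make the left side of the equation positive. Case (a) also uses A ≤ 4US, and the equality case of
(d) is excluded because dU vanishes at a maximum of U. -/

theorem sum_orthonormalBasis_eq {T κ ι : Type*} [NormedAddCommGroup T] [InnerProductSpace ℝ T]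
    [Fintype κ] [Fintype ι] [DecidableEq ι] (b : OrthonormalBasis κ ℝ T) (v : ι → T)
    (hcard : Fintype.card κ = Fintype.card ι) (hv : LinearIndependent ℝ v)
    (β : T →ₗ[ℝ] T →ₗ[ℝ] ℝ) :
    ∑ k, β (b k) (b k) = ∑ i, ∑ j, (Matrix.gram ℝ v)⁻¹ i j * β (v i) (v j) := by
  classical
  set c := b.reindex (Fintype.equivOfCardEq hcard) with hc
  have hbc : ∑ k, β (b k) (b k) = ∑ i, β (c i) (c i) :=
    Fintype.sum_equiv (Fintype.equivOfCardEq hcard) _ _ (by simp [hc])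
  set A : Matrix ι ι ℝ := Matrix.of fun i k ↦ inner ℝ (c k) (v i) with hA
  have hvA : ∀ i, v i = ∑ k, A i k • c k := fun i ↦ (c.sum_repr' (v i)).symm
  have hG : Matrix.gram ℝ v = A * A.transpose := by
    ext i j
    rw [Matrix.gram_apply, Matrix.mul_apply, ← c.sum_inner_mul_inner]
    simp [hA, real_inner_comm]
  have hdet : IsUnit (A * A.transpose).det := by
    rw [← hG]; exact (Matrix.posDef_gram_of_linearIndependent hv).det_pos.ne'.isUnit
  have hAdet : IsUnit A.det := by
    rw [Matrix.det_mul] at hdet; exact isUnit_of_mul_isUnit_left hdet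
  -- With G = A Aᵀ the Gram matrix of `v`, the identity Aᵀ G⁻¹ A = 1 is what makes the contraction
  -- with G⁻¹ collapse to the orthonormal trace.
  have hAinv : A.transpose * (A * A.transpose)⁻¹ * A = 1 := by
    rw [Matrix.mul_inv_rev, ← Matrix.mul_assoc, Matrix.mul_nonsing_inv _ (by simpa using hAdet),
      Matrix.one_mul, Matrix.nonsing_inv_mul _ hAdet]
  set P := (A * A.transpose)⁻¹ with hP
  have key : ∀ k l, ∑ i, ∑ j, P i j * (A i k * A j l) = if k = l then 1 else 0 := by
    intro k l
    have := congrFun (congrFun hAinv k) l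
    rw [Matrix.mul_apply] at this
    simp only [Matrix.mul_apply, Matrix.transpose_apply, Matrix.one_apply] at this
    rw [← this, Finset.sum_comm]
    refine Finset.sum_congr rfl fun i _ ↦ ?_
    rw [Finset.sum_mul]
    exact Finset.sum_congr rfl fun j _ ↦ by ring
  have hβ : ∀ i j, β (v i) (v j) = ∑ k, ∑ l, A i k * A j l * β (c k) (c l) := by
    intro i j
    rw [hvA i, hvA j]
    simp only [map_sum, LinearMap.sum_apply, map_smul, LinearMap.smul_apply, smul_eq_mul,
      Finset.mul_sum]
    rw [Finset.sum_comm]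
    exact Finset.sum_congr rfl fun k _ ↦ Finset.sum_congr rfl fun l _ ↦ by ring
  rw [hbc, hG, ← hP]
  symm
  calc ∑ i, ∑ j, P i j * β (v i) (v j)
      = ∑ i, ∑ j, ∑ k, ∑ l, P i j * (A i k * A j l) * β (c k) (c l) := by
        refine Finset.sum_congr rfl fun i _ ↦ Finset.sum_congr rfl fun j _ ↦ ?_
        rw [hβ]
        simp only [Finset.mul_sum]
        exact Finset.sum_congr rfl fun k _ ↦ Finset.sum_congr rfl fun l _ ↦ by ring
    _ = ∑ k, ∑ l, (∑ i, ∑ j, P i j * (A i k * A j l)) * β (c k) (c l) := by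
        simp only [Finset.sum_mul]
        rw [Finset.sum_congr rfl fun i _ ↦ Finset.sum_comm, Finset.sum_comm]
        refine Finset.sum_congr rfl fun k _ ↦ ?_
        rw [Finset.sum_congr rfl fun i _ ↦ Finset.sum_comm, Finset.sum_comm]
    _ = ∑ k, β (c k) (c k) := by
        simp [key]

/-! ### Analysis on Euclidean space -/

theorem integrable_of_continuousOn_of_eq_zero {X : Type*} [TopologicalSpace X] [T2Space X]
    [MeasurableSpace X] [BorelSpace X] {μ : Measure X} [IsFiniteMeasureOnCompacts μ] {K : Set X}
    (hK : IsCompact K) {f : X → ℝ} (hf : ContinuousOn f K) (h0 : ∀ x ∉ K, f x = 0) :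
    Integrable f μ :=
  (integrableOn_iff_integrable_of_support_subset
    (fun x hx ↦ by_contra fun h ↦ hx (h0 x h))).1 (hf.integrableOn_compact hK)

/-- A compactly supported function is `L²`-orthogonal to a divergence-free vector field, once
differentiated along it. -/
theorem integral_sum_fderiv_mul_eq_zero {n : ℕ} {Ω : Set (EuclideanSpace ℝ (Fin n))}
    (hΩ : IsOpen Ω) {W : Fin n → EuclideanSpace ℝ (Fin n) → ℝ} (hW : ∀ i, ContDiffOn ℝ ∞ (W i) Ω)
    (hdiv : ∀ y ∈ Ω, ∑ i, fderiv ℝ (W i) y (EuclideanSpace.single i (1 : ℝ)) = 0)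
    {h : EuclideanSpace ℝ (Fin n) → ℝ} (hh : ContDiff ℝ ∞ h) (hc : HasCompactSupport h)
    (hs : tsupport h ⊆ Ω) :
    ∫ y, ∑ i, fderiv ℝ h y (EuclideanSpace.single i (1 : ℝ)) * W i y = 0 := by
  have hWc : ∀ i, ContinuousOn (W i) (tsupport h) := fun i ↦ (hW i).continuousOn.mono hs
  have hWd : ∀ i, ContinuousOn (fun y ↦ fderiv ℝ (W i) y (EuclideanSpace.single i (1 : ℝ)))
      (tsupport h) := fun i ↦
    (((hW i).continuousOn_fderiv_of_isOpen hΩ (by simp)).clm_apply continuousOn_const).mono hs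
  have hhd : ∀ v, Continuous fun y ↦ fderiv ℝ h y v := fun v ↦
    (hh.continuous_fderiv (by simp)).clm_apply continuous_const
  have h0 : ∀ y ∉ tsupport h, h y = 0 := fun y hy ↦ image_eq_zero_of_notMem_tsupport hy
  have h0' : ∀ y ∉ tsupport h, fderiv ℝ h y = 0 := fun y hy ↦
    image_eq_zero_of_notMem_tsupport fun h' ↦ hy (tsupport_fderiv_subset ℝ h')
  have i1 : ∀ i, Integrable fun y ↦ fderiv ℝ h y (EuclideanSpace.single i (1 : ℝ)) * W i y :=
    fun i ↦ integrable_of_continuousOn_of_eq_zero hc ((hhd _).continuousOn.mul (hWc i))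
      fun y hy ↦ by simp [h0' y hy]
  have i2 : ∀ i, Integrable fun y ↦ h y * fderiv ℝ (W i) y (EuclideanSpace.single i (1 : ℝ)) :=
    fun i ↦ integrable_of_continuousOn_of_eq_zero hc (hh.continuous.continuousOn.mul (hWd i))
      fun y hy ↦ by simp [h0 y hy]
  have i3 : ∀ i, Integrable fun y ↦ h y * W i y :=
    fun i ↦ integrable_of_continuousOn_of_eq_zero hc (hh.continuous.continuousOn.mul (hWc i))
      fun y hy ↦ by simp [h0 y hy]
  -- Integration by parts in each coordinate. `W i` is differentiable only on `Ω`, which suffices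
  -- because `Ω` contains the support of `h`.
  have parts : ∀ i, ∫ y, fderiv ℝ h y (EuclideanSpace.single i (1 : ℝ)) * W i y =
      -∫ y, h y * fderiv ℝ (W i) y (EuclideanSpace.single i (1 : ℝ)) := by
    intro i
    rw [integral_mul_fderiv_eq_neg_fderiv_mul_of_integrable (i1 i) (i2 i) (i3 i)
      (fun y _ ↦ hh.differentiable (by simp) y)
      (fun y hy ↦ ((hW i).differentiableOn (by simp)).differentiableAt (hΩ.mem_nhds (hs hy))),
      neg_neg]
  rw [integral_finsetSum _ fun i _ ↦ i1 i, Finset.sum_congr rfl fun i _ ↦ parts i,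
    Finset.sum_neg_distrib, ← integral_finsetSum _ fun i _ ↦ i2 i, neg_eq_zero]
  refine integral_eq_zero_of_ae (Filter.Eventually.of_forall fun y ↦ ?_)
  simp only [← Finset.mul_sum, Pi.zero_apply]
  by_cases hy : y ∈ tsupport h
  · rw [hdiv y (hs hy), mul_zero]
  · rw [h0 y hy, zero_mul]

/-- Differentiation under the integral sign: the `t`-derivative is jointly continuous, hence bounded
on the compact set [t₀ - 1, t₀ + 1] × K, and a constant is integrable over `K`. -/
theorem hasDerivAt_setIntegral_of_continuousOn {X : Type*} [TopologicalSpace X] [T2Space X]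
    [MeasurableSpace X] [BorelSpace X] {μ : Measure X} [IsFiniteMeasureOnCompacts μ] {K : Set X}
    (hK : IsCompact K) {F F' : ℝ → X → ℝ} (hF : ∀ t, ContinuousOn (F t) K)
    (hF' : ContinuousOn (fun z : ℝ × X ↦ F' z.1 z.2) (univ ×ˢ K))
    (hd : ∀ t, ∀ x ∈ K, HasDerivAt (fun s ↦ F s x) (F' t x) t) (t₀ : ℝ) :
    HasDerivAt (fun t ↦ ∫ x in K, F t x ∂μ) (∫ x in K, F' t₀ x ∂μ) t₀ := by
  obtain ⟨C, hC⟩ := ((isCompact_Icc (a := t₀ - 1) (b := t₀ + 1)).prod hK).exists_bound_of_continuousOn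
    (hF'.mono (prod_mono (subset_univ _) subset_rfl))
  have hKm : MeasurableSet K := hK.isClosed.measurableSet
  have hF'0 : ContinuousOn (F' t₀) K :=
    hF'.comp (f := fun x ↦ (t₀, x)) (by fun_prop) fun x hx ↦ ⟨mem_univ _, hx⟩
  refine (hasDerivAt_integral_of_dominated_loc_of_deriv_le (bound := fun _ ↦ C) (F' := F')
    (s := Icc (t₀ - 1) (t₀ + 1)) (Icc_mem_nhds (by linarith) (by linarith))
    (Filter.Eventually.of_forall fun t ↦ ((hF t).integrableOn_compact hK).aestronglyMeasurable)
    ((hF t₀).integrableOn_compact hK) (hF'0.integrableOn_compact hK).aestronglyMeasurable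
    ?_ ?_ ?_).2
  · exact (ae_restrict_iff' hKm).2 (.of_forall fun x hx t ht ↦ hC (t, x) ⟨ht, hx⟩)
  · exact continuousOn_const.integrableOn_compact hK
  · exact (ae_restrict_iff' hKm).2 (.of_forall fun x hx t _ ↦ hd t x hx)

/-! ### Smoothness of determinants and inverse matrices -/

section Matrix

variable {X : Type*} [NormedAddCommGroup X] [NormedSpace ℝ X] {ι : Type*} [Fintype ι]
  [DecidableEq ι] {A : X → Matrix ι ι ℝ} {s : Set X} {k : ℕ∞ω}

theorem contDiffOn_det (hA : ∀ i j, ContDiffOn ℝ k (fun x ↦ A x i j) s) :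
    ContDiffOn ℝ k (fun x ↦ (A x).det) s := by
  simp only [Matrix.det_apply]
  exact ContDiffOn.sum fun σ _ ↦ (contDiffOn_prod fun i _ ↦ hA _ _).const_smul _

theorem contDiffOn_inv_apply (hA : ∀ i j, ContDiffOn ℝ k (fun x ↦ A x i j) s)
    (hdet : ∀ x ∈ s, (A x).det ≠ 0) (i j : ι) : ContDiffOn ℝ k (fun x ↦ (A x)⁻¹ i j) s := by
  -- Cramer's rule: an adjugate entry is the determinant of the matrix with one row replaced by a
  -- constant vector.
  simp only [Matrix.inv_def, Matrix.smul_apply, Ring.inverse_eq_inv', smul_eq_mul,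
    Matrix.adjugate_apply]
  refine ((contDiffOn_det hA).inv hdet).mul (contDiffOn_det fun a b ↦ ?_)
  by_cases hab : a = j
  · subst hab; simpa using contDiffOn_const
  · simpa [Matrix.updateRow_ne hab] using hA a b

end Matrix

/-! ### Coordinate vectors and the metric in a chart -/

section Chart

variable {n : ℕ} {M : Type*} [TopologicalSpace M] [ChartedSpace (EuclideanSpace ℝ (Fin n)) M]
  [IsManifold (𝓡 n) ∞ M] {e e' : OpenPartialHomeomorph M (EuclideanSpace ℝ (Fin n))}

theorem mdifferentiable_of_mem_maximalAtlas (he : e ∈ IsManifold.maximalAtlas (𝓡 n) ∞ M) :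
    e.MDifferentiable (𝓡 n) (𝓡 n) :=
  ⟨(contMDiffOn_of_mem_maximalAtlas he).mdifferentiableOn (by simp),
    (contMDiffOn_symm_of_mem_maximalAtlas he).mdifferentiableOn (by simp)⟩

theorem linearIndependent_coordVector (he : e ∈ IsManifold.maximalAtlas (𝓡 n) ∞ M)
    {y : EuclideanSpace ℝ (Fin n)} (hy : y ∈ e.target) : LinearIndependent ℝ (coordVector e y) := by
  have h1 : LinearIndependent ℝ fun i : Fin n ↦ EuclideanSpace.single i (1 : ℝ) := by
    rw [← funext (EuclideanSpace.basisFun_apply (Fin n) ℝ)]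
    exact (EuclideanSpace.basisFun (Fin n) ℝ).orthonormal.linearIndependent
  exact h1.map' (mfderiv (𝓡 n) (𝓡 n) e.symm y).toLinearMap
    ((mdifferentiable_of_mem_maximalAtlas he).symm.ker_mfderiv_eq_bot hy)

theorem contMDiffOn_coordVector (he : e ∈ IsManifold.maximalAtlas (𝓡 n) ∞ M) (i : Fin n) :
    ContMDiffOn (𝓡 n) ((𝓡 n).prod (𝓡 n)) ∞
      (fun y ↦ (coordVector e y i : TangentBundle (𝓡 n) M)) e.target := by
  have h1 := (contMDiffOn_symm_of_mem_maximalAtlas he).contMDiffOn_tangentMapWithin (m := ∞)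
    (by simp) e.open_target.uniqueMDiffOn
  have h2 : ContMDiff (𝓡 n) ((𝓡 n).prod (𝓡 n)) ∞ (fun y : EuclideanSpace ℝ (Fin n) ↦
      (⟨y, EuclideanSpace.single i (1 : ℝ)⟩ : TangentBundle (𝓡 n) (EuclideanSpace ℝ (Fin n)))) := by
    exact contMDiff_vectorSpace_iff_contDiff.2 contDiff_const
  refine (h1.comp h2.contMDiffOn fun y hy ↦ hy).congr fun y hy ↦ ?_
  simp only [Function.comp, tangentMapWithin, coordVector]
  rw [mfderivWithin_of_isOpen e.open_target hy]

theorem contDiffOn_comp_symm {u : M → ℝ} (hu : ContMDiff (𝓡 n) 𝓘(ℝ, ℝ) ∞ u)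
    (he : e ∈ IsManifold.maximalAtlas (𝓡 n) ∞ M) :
    ContDiffOn ℝ ∞ (fun y ↦ u (e.symm y)) e.target :=
  (hu.comp_contMDiffOn (contMDiffOn_symm_of_mem_maximalAtlas he)).contDiffOn

theorem mvfderiv_coordVector {u : M → ℝ} (he : e ∈ IsManifold.maximalAtlas (𝓡 n) ∞ M)
    {y : EuclideanSpace ℝ (Fin n)} (hy : y ∈ e.target)
    (hu : MDifferentiableAt (𝓡 n) 𝓘(ℝ, ℝ) u (e.symm y)) (i : Fin n) :
    mvfderiv (𝓡 n) u (e.symm y) (coordVector e y i) =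
      fderiv ℝ (fun z ↦ u (e.symm z)) y (EuclideanSpace.single i (1 : ℝ)) := by
  have := mfderiv_comp y hu ((mdifferentiable_of_mem_maximalAtlas he).mdifferentiableAt_symm hy)
  rw [mfderiv_eq_fderiv] at this
  exact (congrArg (fun L ↦ L (EuclideanSpace.single i (1 : ℝ))) this).symm

variable [RiemannianBundle (fun x : M ↦ TangentSpace (𝓡 n) x)]

theorem det_metricMatrix_pos (he : e ∈ IsManifold.maximalAtlas (𝓡 n) ∞ M)
    {y : EuclideanSpace ℝ (Fin n)} (hy : y ∈ e.target) : 0 < (metricMatrix e y).det :=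
  (Matrix.posDef_gram_of_linearIndependent (linearIndependent_coordVector he hy)).det_pos

theorem volumeDensity_pos (he : e ∈ IsManifold.maximalAtlas (𝓡 n) ∞ M)
    {y : EuclideanSpace ℝ (Fin n)} (hy : y ∈ e.target) : 0 < volumeDensity e y :=
  Real.sqrt_pos.2 (det_metricMatrix_pos he hy)

/-- The trace of a bilinear form on a tangent space, in coordinates. -/
theorem sum_stdOrthonormalBasis_eq (he : e ∈ IsManifold.maximalAtlas (𝓡 n) ∞ M)
    {y : EuclideanSpace ℝ (Fin n)} (hy : y ∈ e.target)
    (β : TangentSpace (𝓡 n) (e.symm y) →ₗ[ℝ] TangentSpace (𝓡 n) (e.symm y) →ₗ[ℝ] ℝ) :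
    ∑ k, β (stdOrthonormalBasis ℝ (TangentSpace (𝓡 n) (e.symm y)) k)
        (stdOrthonormalBasis ℝ (TangentSpace (𝓡 n) (e.symm y)) k) =
      ∑ i, ∑ j, (metricMatrix e y)⁻¹ i j * β (coordVector e y i) (coordVector e y j) :=
  sum_orthonormalBasis_eq _ _
    (by
      rw [Fintype.card_fin, Fintype.card_fin]
      exact finrank_euclideanSpace_fin (𝕜 := ℝ) (n := n))
    (linearIndependent_coordVector he hy) β

variable [IsContMDiffRiemannianBundle (𝓡 n) ∞ (EuclideanSpace ℝ (Fin n))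
  (fun x : M ↦ TangentSpace (𝓡 n) x)]

theorem contDiffOn_metricMatrix (he : e ∈ IsManifold.maximalAtlas (𝓡 n) ∞ M) (i j : Fin n) :
    ContDiffOn ℝ ∞ (fun y ↦ metricMatrix e y i j) e.target :=
  ((contMDiffOn_coordVector he i).inner_bundle (contMDiffOn_coordVector he j)).contDiffOn

theorem contDiffOn_inv_metricMatrix (he : e ∈ IsManifold.maximalAtlas (𝓡 n) ∞ M) (i j : Fin n) :
    ContDiffOn ℝ ∞ (fun y ↦ (metricMatrix e y)⁻¹ i j) e.target :=
  contDiffOn_inv_apply (contDiffOn_metricMatrix he) (fun _ hy ↦ (det_metricMatrix_pos he hy).ne') i j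

theorem contDiffOn_volumeDensity (he : e ∈ IsManifold.maximalAtlas (𝓡 n) ∞ M) :
    ContDiffOn ℝ ∞ (volumeDensity e) e.target :=
  (contDiffOn_det (contDiffOn_metricMatrix he)).sqrt fun _ hy ↦ (det_metricMatrix_pos he hy).ne'

end Chart

/-! ### The Riemannian measure in a chart -/

section Chart

variable {n : ℕ} {M : Type*} [TopologicalSpace M] [ChartedSpace (EuclideanSpace ℝ (Fin n)) M]
  [IsManifold (𝓡 n) ∞ M] {e e' : OpenPartialHomeomorph M (EuclideanSpace ℝ (Fin n))}
  [RiemannianBundle (fun x : M ↦ TangentSpace (𝓡 n) x)]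

/-- Needed because `e.symm y` and `e'.symm (e' (e.symm y))` are equal but not definitionally so. All
tangent spaces unfold to the model space, so only the inner product has to be transported. -/
theorem inner_tangentSpace_congr {x x' : M} (h : x = x') (a b : EuclideanSpace ℝ (Fin n)) :
    @inner ℝ (TangentSpace (𝓡 n) x) _ a b = @inner ℝ (TangentSpace (𝓡 n) x') _ a b := by
  subst h; rfl

theorem contDiffAt_transition (he : e ∈ IsManifold.maximalAtlas (𝓡 n) ∞ M)
    (he' : e' ∈ IsManifold.maximalAtlas (𝓡 n) ∞ M) {y : EuclideanSpace ℝ (Fin n)}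
    (hy : y ∈ e.target) (hy' : e.symm y ∈ e'.source) :
    ContDiffAt ℝ ∞ (fun z ↦ e' (e.symm z)) y :=
  ((contMDiffAt_of_mem_maximalAtlas he' hy').comp y
    (contMDiffAt_symm_of_mem_maximalAtlas he hy)).contDiffAt

theorem coordVector_eq_mfderiv_transition (he : e ∈ IsManifold.maximalAtlas (𝓡 n) ∞ M)
    (he' : e' ∈ IsManifold.maximalAtlas (𝓡 n) ∞ M) {y : EuclideanSpace ℝ (Fin n)}
    (hy : y ∈ e.target) (hy' : e.symm y ∈ e'.source) (i : Fin n) :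
    coordVector e y i = mfderiv (𝓡 n) (𝓡 n) e'.symm (e' (e.symm y))
      (fderiv ℝ (fun z ↦ e' (e.symm z)) y (EuclideanSpace.single i (1 : ℝ))) := by
  have h1 : HasMFDerivAt (𝓡 n) (𝓡 n) (fun z ↦ e' (e.symm z)) y
      (fderiv ℝ (fun z ↦ e' (e.symm z)) y) :=
    ((contDiffAt_transition he he' hy hy').differentiableAt (by simp)).hasFDerivAt.hasMFDerivAt
  have h2 := ((mdifferentiable_of_mem_maximalAtlas he').mdifferentiableAt_symm
    (e'.map_source hy')).hasMFDerivAt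
  have h3 := (h2.comp y h1).congr_of_eventuallyEq (f₁ := e.symm) (by
    filter_upwards [e.symm.continuousAt hy |>.preimage_mem_nhds (e'.open_source.mem_nhds hy')]
      with z hz
    exact (e'.left_inv hz).symm)
  exact congrArg (fun L ↦ L (EuclideanSpace.single i (1 : ℝ))) h3.mfderiv

theorem metricMatrix_transition (he : e ∈ IsManifold.maximalAtlas (𝓡 n) ∞ M)
    (he' : e' ∈ IsManifold.maximalAtlas (𝓡 n) ∞ M) {y : EuclideanSpace ℝ (Fin n)}
    (hy : y ∈ e.target) (hy' : e.symm y ∈ e'.source) :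
    metricMatrix e y =
      (LinearMap.toMatrix (EuclideanSpace.basisFun (Fin n) ℝ).toBasis
        (EuclideanSpace.basisFun (Fin n) ℝ).toBasis
        (fderiv ℝ (fun z ↦ e' (e.symm z)) y : _ →ₗ[ℝ] _)).transpose *
      metricMatrix e' (e' (e.symm y)) *
      LinearMap.toMatrix (EuclideanSpace.basisFun (Fin n) ℝ).toBasis
        (EuclideanSpace.basisFun (Fin n) ℝ).toBasis
        (fderiv ℝ (fun z ↦ e' (e.symm z)) y : _ →ₗ[ℝ] _) := by
  set J := LinearMap.toMatrix (EuclideanSpace.basisFun (Fin n) ℝ).toBasis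
        (EuclideanSpace.basisFun (Fin n) ℝ).toBasis
        (fderiv ℝ (fun z ↦ e' (e.symm z)) y : _ →ₗ[ℝ] _) with hJ
  have hJe : ∀ i, fderiv ℝ (fun z ↦ e' (e.symm z)) y (EuclideanSpace.single i (1 : ℝ)) =
      ∑ k, J k i • EuclideanSpace.single k (1 : ℝ) := by
    intro i
    have := ((EuclideanSpace.basisFun (Fin n) ℝ).toBasis.sum_repr
      (fderiv ℝ (fun z ↦ e' (e.symm z)) y (EuclideanSpace.single i (1 : ℝ)))).symm
    simpa [hJ, LinearMap.toMatrix_apply] using this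
  have hcv : ∀ i, (coordVector e y i : EuclideanSpace ℝ (Fin n)) =
      (∑ k, J k i • coordVector e' (e' (e.symm y)) k :
        TangentSpace (𝓡 n) (e'.symm (e' (e.symm y)))) := by
    intro i
    rw [coordVector_eq_mfderiv_transition he he' hy hy', hJe]
    exact (map_sum _ _ _).trans (Finset.sum_congr rfl fun k _ ↦ map_smul _ _ _)
  ext i j
  have h1 : metricMatrix e y i j =
      @inner ℝ (TangentSpace (𝓡 n) (e'.symm (e' (e.symm y)))) _
        (∑ k, J k i • coordVector e' (e' (e.symm y)) k)
        (∑ k, J k j • coordVector e' (e' (e.symm y)) k) := by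
    rw [← hcv, ← hcv]
    exact inner_tangentSpace_congr (e'.left_inv hy').symm _ _
  rw [h1, Matrix.mul_assoc, Matrix.mul_apply]
  simp only [sum_inner, inner_sum, Matrix.mul_apply, Matrix.transpose_apply, Finset.mul_sum,
    real_inner_smul_left, real_inner_smul_right]
  rw [Finset.sum_comm]
  refine Finset.sum_congr rfl fun k _ ↦ Finset.sum_congr rfl fun l _ ↦ ?_
  rw [show metricMatrix e' (e' (e.symm y)) k l = inner ℝ (coordVector e' (e' (e.symm y)) k)
    (coordVector e' (e' (e.symm y)) l) from rfl]
  ring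

theorem volumeDensity_transition (he : e ∈ IsManifold.maximalAtlas (𝓡 n) ∞ M)
    (he' : e' ∈ IsManifold.maximalAtlas (𝓡 n) ∞ M) {y : EuclideanSpace ℝ (Fin n)}
    (hy : y ∈ e.target) (hy' : e.symm y ∈ e'.source) :
    volumeDensity e y = |(fderiv ℝ (fun z ↦ e' (e.symm z)) y).det| *
      volumeDensity e' (e' (e.symm y)) := by
  rw [volumeDensity, metricMatrix_transition he he' hy hy', Matrix.det_mul, Matrix.det_mul,
    Matrix.det_transpose, LinearMap.det_toMatrix, mul_right_comm, ← sq,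
    Real.sqrt_mul (sq_nonneg _), Real.sqrt_sq_eq_abs]
  rfl

variable [MeasurableSpace M] [BorelSpace M]

theorem measurableSet_target_inter_preimage (e : OpenPartialHomeomorph M (EuclideanSpace ℝ (Fin n)))
    {A : Set M} (hA : MeasurableSet A) : MeasurableSet (e.target ∩ e.symm ⁻¹' A) := by
  have h1 : Measurable (e.target.domRestrict e.symm) :=
    (continuousOn_iff_continuous_domRestrict.1 e.continuousOn_symm).measurable
  convert! e.open_target.measurableSet.subtype_image (h1 hA) using 1
  ext y
  simp [and_comm]

theorem aemeasurable_symm (e : OpenPartialHomeomorph M (EuclideanSpace ℝ (Fin n)))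
    (f : EuclideanSpace ℝ (Fin n) → ℝ≥0∞) :
    AEMeasurable e.symm ((volume.restrict e.target).withDensity f) :=
  (e.continuousOn_symm.aemeasurable e.open_target.measurableSet).mono_ac
    (withDensity_absolutelyContinuous _ _)

theorem chartVolume_apply (e : OpenPartialHomeomorph M (EuclideanSpace ℝ (Fin n)))
    {A : Set M} (hA : MeasurableSet A) :
    chartVolume e A = ∫⁻ y in e.target ∩ e.symm ⁻¹' A, ENNReal.ofReal (volumeDensity e y) := by
  rw [chartVolume, Measure.map_apply_of_aemeasurable (aemeasurable_symm e _) hA,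
    withDensity_apply', Measure.restrict_restrict' e.open_target.measurableSet, inter_comm]

/-- Change of variables along the transition map, whose Jacobian is absorbed by
`volumeDensity_transition`. Only an inequality holds, since `A` may stick out of the domain of `e`,
where `chartVolume e` sees nothing. -/
theorem chartVolume_le_of_subset (he : e ∈ IsManifold.maximalAtlas (𝓡 n) ∞ M)
    (he' : e' ∈ IsManifold.maximalAtlas (𝓡 n) ∞ M) {A : Set M} (hA : MeasurableSet A)
    (hAe : A ⊆ e'.source) : chartVolume e A ≤ chartVolume e' A := by
  rw [chartVolume_apply e hA, chartVolume_apply e' hA]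
  set s := e.target ∩ e.symm ⁻¹' A with hs
  have hsm : MeasurableSet s := measurableSet_target_inter_preimage e hA
  have hinj : InjOn (fun z ↦ e' (e.symm z)) s := fun y hy z hz h ↦
    e.symm.injOn hy.1 hz.1 (e'.injOn (hAe hy.2) (hAe hz.2) h)
  have hsub : (fun z ↦ e' (e.symm z)) '' s ⊆ e'.target ∩ e'.symm ⁻¹' A := by
    rintro _ ⟨y, hy, rfl⟩
    exact ⟨e'.map_source (hAe hy.2), by simpa [e'.left_inv (hAe hy.2)] using hy.2⟩
  calc ∫⁻ y in s, ENNReal.ofReal (volumeDensity e y)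
      = ∫⁻ y in s, ENNReal.ofReal |(fderiv ℝ (fun z ↦ e' (e.symm z)) y).det| *
          ENNReal.ofReal (volumeDensity e' (e' (e.symm y))) := by
        refine setLIntegral_congr_fun hsm fun y hy ↦ ?_
        rw [volumeDensity_transition he he' hy.1 (hAe hy.2), ENNReal.ofReal_mul (abs_nonneg _)]
    _ = ∫⁻ y in (fun z ↦ e' (e.symm z)) '' s, ENNReal.ofReal (volumeDensity e' y) :=
        (lintegral_image_eq_lintegral_abs_det_fderiv_mul volume hsm (fun y hy ↦
          ((contDiffAt_transition he he' hy.1 (hAe hy.2)).differentiableAt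
            (by simp)).hasFDerivAt.hasFDerivWithinAt) hinj
          fun y ↦ ENNReal.ofReal (volumeDensity e' y)).symm
    _ ≤ _ := lintegral_mono_set hsub

theorem riemannianVolume_apply (he : e ∈ IsManifold.maximalAtlas (𝓡 n) ∞ M) {A : Set M}
    (hA : MeasurableSet A) (hAe : A ⊆ e.source) : riemannianVolume n M A = chartVolume e A := by
  refine le_antisymm ?_ ((le_iSup₂ (f := fun e _ ↦ chartVolume e) e he : _ ≤ riemannianVolume n M) A)
  -- A supremum of measures is not computed set by set. It is bounded instead by one measure
  -- dominating every chart measure: `chartVolume e` handles the part inside the domain of `e`, and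
  -- the largest measure handles the part outside, which does not meet `A`.
  have hle : riemannianVolume n M ≤ chartVolume e + (⊤ : Measure M).restrict e.sourceᶜ := by
    refine iSup₂_le fun e' he' ↦ Measure.le_iff.2 fun B hB ↦ ?_
    rw [← measure_inter_add_sdiff B e.open_source.measurableSet, Measure.add_apply]
    refine add_le_add ((chartVolume_le_of_subset he' he (hB.inter e.open_source.measurableSet)
      inter_subset_right).trans (measure_mono inter_subset_left)) ?_
    rw [Measure.restrict_apply hB, ← sdiff_eq]
    exact (le_top : chartVolume e' ≤ ⊤) _
  refine (hle A).trans ?_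
  rw [Measure.add_apply, Measure.restrict_apply hA, ← sdiff_eq, sdiff_eq_empty.2 hAe, measure_empty,
    add_zero]

theorem restrict_riemannianVolume (he : e ∈ IsManifold.maximalAtlas (𝓡 n) ∞ M) {K : Set M}
    (hK : MeasurableSet K) (hKe : K ⊆ e.source) :
    (riemannianVolume n M).restrict K = (chartVolume e).restrict K := by
  ext A hA
  rw [Measure.restrict_apply hA, Measure.restrict_apply hA,
    riemannianVolume_apply he (hA.inter hK) (inter_subset_right.trans hKe)]

variable [IsContMDiffRiemannianBundle (𝓡 n) ∞ (EuclideanSpace ℝ (Fin n))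
  (fun x : M ↦ TangentSpace (𝓡 n) x)]

theorem setIntegral_riemannianVolume [T2Space M] (he : e ∈ IsManifold.maximalAtlas (𝓡 n) ∞ M)
    {K : Set (EuclideanSpace ℝ (Fin n))} (hK : IsCompact K) (hKe : K ⊆ e.target) {F : M → ℝ}
    (hF : ContinuousOn (fun y ↦ F (e.symm y)) K) :
    ∫ x in e.symm '' K, F x ∂(riemannianVolume n M) =
      ∫ y in K, volumeDensity e y * F (e.symm y) := by
  have hcK : IsCompact (e.symm '' K) := hK.image_of_continuousOn (e.continuousOn_symm.mono hKe)
  have hmK : MeasurableSet (e.symm '' K) := hcK.isClosed.measurableSet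
  have hKs : e.symm '' K ⊆ e.source := by
    rintro _ ⟨y, hy, rfl⟩; exact e.map_target (hKe hy)
  have hmem : ∀ y ∈ e.target, (e.symm y ∈ e.symm '' K ↔ y ∈ K) := fun y hy ↦
    ⟨fun ⟨z, hz, h⟩ ↦ by rwa [← e.symm.injOn (hKe hz) hy h], fun h ↦ mem_image_of_mem _ h⟩
  have hFc : ContinuousOn F (e.symm '' K) := by
    refine (hF.comp (e.continuousOn.mono hKs) ?_).congr fun x hx ↦ ?_
    · rintro _ ⟨y, hy, rfl⟩; rwa [e.right_inv (hKe hy)]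
    · simp [e.left_inv (hKs hx)]
  -- The density is controlled only on the target of `e`, so measurability is claimed only almost
  -- everywhere for the restricted measure.
  have hdens : AEMeasurable (fun y ↦ ENNReal.ofReal (volumeDensity e y))
      (volume.restrict e.target) :=
    ((contDiffOn_volumeDensity he).continuousOn.aemeasurable
      e.open_target.measurableSet).ennreal_ofReal
  rw [restrict_riemannianVolume he hmK hKs, ← integral_indicator hmK, chartVolume,
    integral_map (aemeasurable_symm e _)
      ((aestronglyMeasurable_indicator_iff hmK).2 (hFc.aestronglyMeasurable hmK)),
    integral_withDensity_eq_integral_toReal_smul₀ hdens (by simp)]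
  rw [← integral_indicator e.open_target.measurableSet,
    ← integral_indicator hK.isClosed.measurableSet]
  congr 1
  ext y
  by_cases hy : y ∈ e.target
  · by_cases hyK : y ∈ K
    · rw [indicator_of_mem hy, indicator_of_mem hyK, indicator_of_mem ((hmem y hy).2 hyK),
        ENNReal.toReal_ofReal (volumeDensity_pos he hy).le, smul_eq_mul]
    · rw [indicator_of_mem hy, indicator_of_notMem hyK,
        indicator_of_notMem (mt (hmem y hy).1 hyK), smul_zero]
  · rw [indicator_of_notMem hy, indicator_of_notMem fun h ↦ hy (hKe h)]

end Chart

/-! ### The energy density of a multiple of a section -/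

section Sections

variable {n : ℕ} {M : Type*} [TopologicalSpace M] [ChartedSpace (EuclideanSpace ℝ (Fin n)) M]
  [IsManifold (𝓡 n) ∞ M] [RiemannianBundle (fun x : M ↦ TangentSpace (𝓡 n) x)]
  [IsContMDiffRiemannianBundle (𝓡 n) ∞ (EuclideanSpace ℝ (Fin n))
    (fun x : M ↦ TangentSpace (𝓡 n) x)]
  {V : Type*} [NormedAddCommGroup V] [NormedSpace ℝ V]
  {E : M → Type*} [TopologicalSpace (TotalSpace V E)] [∀ x, NormedAddCommGroup (E x)]
  [∀ x, InnerProductSpace ℝ (E x)] [FiberBundle V E] [VectorBundle ℝ V E]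
  {cov : CovariantDerivative (𝓡 n) V E} {σ : Π x, E x}
  {e : OpenPartialHomeomorph M (EuclideanSpace ℝ (Fin n))}

variable (n) in
/-- The Riemannian inner product of the differentials of two functions. -/
def gradInner (f h : M → ℝ) (x : M) : ℝ :=
  ∑ k, mvfderiv (𝓡 n) f x (stdOrthonormalBasis ℝ (TangentSpace (𝓡 n) x) k) *
    mvfderiv (𝓡 n) h x (stdOrthonormalBasis ℝ (TangentSpace (𝓡 n) x) k)

/-- `|∇σ|²`. -/
def covNormSq (cov : CovariantDerivative (𝓡 n) V E) (σ : Π x, E x) (x : M) : ℝ :=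
  ∑ k, ‖cov σ x (stdOrthonormalBasis ℝ (TangentSpace (𝓡 n) x) k)‖ ^ 2

/-- The orthonormal bases are chosen point by point with no regularity; passing to g^{ij} and
partial derivatives is what makes continuity in `y` visible. -/
theorem gradInner_symm (he : e ∈ IsManifold.maximalAtlas (𝓡 n) ∞ M)
    {y : EuclideanSpace ℝ (Fin n)} (hy : y ∈ e.target) {f h : M → ℝ}
    (hf : MDifferentiableAt (𝓡 n) 𝓘(ℝ, ℝ) f (e.symm y))
    (hh : MDifferentiableAt (𝓡 n) 𝓘(ℝ, ℝ) h (e.symm y)) :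
    gradInner n f h (e.symm y) = ∑ i, ∑ j, (metricMatrix e y)⁻¹ i j *
      (fderiv ℝ (fun z ↦ f (e.symm z)) y (EuclideanSpace.single i (1 : ℝ)) *
        fderiv ℝ (fun z ↦ h (e.symm z)) y (EuclideanSpace.single j (1 : ℝ))) := by
  have := sum_stdOrthonormalBasis_eq he hy
    ((LinearMap.mul ℝ ℝ).compl₁₂ (mvfderiv (𝓡 n) f (e.symm y)).toLinearMap
      (mvfderiv (𝓡 n) h (e.symm y)).toLinearMap)
  simp only [LinearMap.compl₁₂_apply, LinearMap.mul_apply', ContinuousLinearMap.coe_coe] at this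
  rw [gradInner, this]
  simp only [mvfderiv_coordVector he hy hf, mvfderiv_coordVector he hy hh]

theorem covNormSq_symm (he : e ∈ IsManifold.maximalAtlas (𝓡 n) ∞ M)
    {y : EuclideanSpace ℝ (Fin n)} (hy : y ∈ e.target) :
    covNormSq cov σ (e.symm y) = ∑ i, ∑ j, (metricMatrix e y)⁻¹ i j *
      inner ℝ (cov σ (e.symm y) (coordVector e y i)) (cov σ (e.symm y) (coordVector e y j)) := by
  have := sum_stdOrthonormalBasis_eq he hy
    ((innerₗ (E (e.symm y))).compl₁₂ (cov σ (e.symm y)).toLinearMap (cov σ (e.symm y)).toLinearMap)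
  simp only [LinearMap.compl₁₂_apply, innerₗ_apply_apply, ContinuousLinearMap.coe_coe] at this
  rw [covNormSq, ← this]
  simp only [real_inner_self_eq_norm_sq]

theorem continuousOn_gradInner_symm (he : e ∈ IsManifold.maximalAtlas (𝓡 n) ∞ M) {f h : M → ℝ}
    (hf : ContMDiff (𝓡 n) 𝓘(ℝ, ℝ) ∞ f) (hh : ContMDiff (𝓡 n) 𝓘(ℝ, ℝ) ∞ h) :
    ContinuousOn (fun y ↦ gradInner n f h (e.symm y)) e.target := by
  have hd : ∀ {f : M → ℝ}, ContMDiff (𝓡 n) 𝓘(ℝ, ℝ) ∞ f → ∀ i, ContinuousOn (fun y ↦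
      fderiv ℝ (fun z ↦ f (e.symm z)) y (EuclideanSpace.single i (1 : ℝ))) e.target := fun hf i ↦
    ((contDiffOn_comp_symm hf he).continuousOn_fderiv_of_isOpen e.open_target
      (by simp)).clm_apply continuousOn_const
  refine ContinuousOn.congr (continuousOn_finsetSum _ fun i _ ↦ continuousOn_finsetSum _ fun j _ ↦
    ((contDiffOn_inv_metricMatrix he i j).continuousOn.mul ((hd hf i).mul (hd hh j))))
    fun y hy ↦ gradInner_symm he hy (hf.mdifferentiable (by simp) _)
      (hh.mdifferentiable (by simp) _)

variable [ContMDiffVectorBundle ∞ V E (𝓡 n)] [IsContMDiffRiemannianBundle (𝓡 n) ∞ V E]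

theorem contMDiff_norm_sq
    (hσ : ContMDiff (𝓡 n) ((𝓡 n).prod 𝓘(ℝ, V)) ∞ (fun x ↦ TotalSpace.mk' V x (σ x))) :
    ContMDiff (𝓡 n) 𝓘(ℝ, ℝ) ∞ fun x ↦ ‖σ x‖ ^ 2 := by
  simpa only [real_inner_self_eq_norm_sq] using hσ.inner_bundle hσ

theorem continuousOn_covNormSq_symm [CovariantDerivative.ContMDiffCovariantDerivative cov ∞]
    (hσ : ContMDiff (𝓡 n) ((𝓡 n).prod 𝓘(ℝ, V)) ∞ (fun x ↦ TotalSpace.mk' V x (σ x)))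
    (he : e ∈ IsManifold.maximalAtlas (𝓡 n) ∞ M) :
    ContinuousOn (fun y ↦ covNormSq cov σ (e.symm y)) e.target := by
  have h1 := (CovariantDerivative.ContMDiffCovariantDerivative.contMDiff (cov := cov)
    (k := ∞)).contMDiff (σ := σ) (by simpa using hσ.contMDiffOn)
  have h2 : ∀ i, ContMDiffOn (𝓡 n) ((𝓡 n).prod 𝓘(ℝ, V)) ∞ (fun y ↦ TotalSpace.mk' V (e.symm y)
      (cov σ (e.symm y) (coordVector e y i))) e.target := fun i ↦
    ContMDiffOn.clm_bundle_apply
      (h1.comp (contMDiffOn_symm_of_mem_maximalAtlas he) fun _ _ ↦ mem_univ _)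
      (contMDiffOn_coordVector he i)
  refine ContinuousOn.congr (continuousOn_finsetSum _ fun i _ ↦ continuousOn_finsetSum _ fun j _ ↦
    ((contDiffOn_inv_metricMatrix he i j).continuousOn.mul
      ((h2 i).inner_bundle (h2 j)).continuousOn)) fun y hy ↦ covNormSq_symm he hy

variable [FiniteDimensional ℝ V]

theorem mvfderiv_norm_sq (hcov : cov.IsMetricCompatible) {x : M}
    (hσ : MDifferentiableAt (𝓡 n) ((𝓡 n).prod 𝓘(ℝ, V)) (fun x ↦ TotalSpace.mk' V x (σ x)) x)
    (X : TangentSpace (𝓡 n) x) :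
    mvfderiv (𝓡 n) (fun x ↦ ‖σ x‖ ^ 2) x X = 2 * inner ℝ (cov σ x X) (σ x) := by
  classical
  -- Compatibility is phrased for vector fields, but only the value at `x` enters, so `X` is
  -- extended by zero.
  have := hcov.mvfderiv_inner_eq (Function.update 0 x X) hσ hσ
  simp only [Function.update_self, real_inner_self_eq_norm_sq] at this
  rw [this, real_inner_comm]
  ring

/-- Cauchy-Schwarz in the fibre, applied to dU(X) = 2⟨∇_X σ, σ⟩ for each basis vector X. -/
theorem gradInner_norm_sq_self_le (hcov : cov.IsMetricCompatible) {x : M}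
    (hσ : MDifferentiableAt (𝓡 n) ((𝓡 n).prod 𝓘(ℝ, V)) (fun x ↦ TotalSpace.mk' V x (σ x)) x) :
    gradInner n (fun x ↦ ‖σ x‖ ^ 2) (fun x ↦ ‖σ x‖ ^ 2) x ≤ 4 * ‖σ x‖ ^ 2 * covNormSq cov σ x := by
  rw [gradInner, covNormSq, Finset.mul_sum]
  refine Finset.sum_le_sum fun k _ ↦ ?_
  rw [mvfderiv_norm_sq hcov hσ]
  nlinarith [real_inner_mul_inner_self_le
    (cov σ x (stdOrthonormalBasis ℝ (TangentSpace (𝓡 n) x) k)) (σ x),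
    real_inner_self_eq_norm_sq (cov σ x (stdOrthonormalBasis ℝ (TangentSpace (𝓡 n) x) k)),
    real_inner_self_eq_norm_sq (σ x)]

/-- By the Leibniz rule ∇_X(mσ) = m ∇_X σ + dm(X) σ, and each product ⟨∇_X σ, σ⟩ is dU(X)/2; thus no
information on σ beyond U, |∇σ|² and dU survives. -/
theorem verticalNormSq_smul (hcov : cov.IsMetricCompatible) {x : M} {m : M → ℝ}
    (hσ : MDifferentiableAt (𝓡 n) ((𝓡 n).prod 𝓘(ℝ, V)) (fun x ↦ TotalSpace.mk' V x (σ x)) x)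
    (hm : MDifferentiableAt (𝓡 n) 𝓘(ℝ, ℝ) m x) (p q : ℝ) :
    verticalNormSq cov p q (m • σ) x = (1 / (1 + m x ^ 2 * ‖σ x‖ ^ 2)) ^ p *
      (m x ^ 2 * covNormSq cov σ x + m x * gradInner n m (fun x ↦ ‖σ x‖ ^ 2) x +
        gradInner n m m x * ‖σ x‖ ^ 2 +
        q * m x ^ 2 * (m x ^ 2 / 4 * gradInner n (fun x ↦ ‖σ x‖ ^ 2) (fun x ↦ ‖σ x‖ ^ 2) x +
          m x * ‖σ x‖ ^ 2 * gradInner n m (fun x ↦ ‖σ x‖ ^ 2) x +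
          ‖σ x‖ ^ 4 * gradInner n m m x)) := by
  simp only [verticalNormSq, verticalMetric, gradInner, covNormSq, Finset.mul_sum, Finset.sum_mul,
    ← Finset.sum_add_distrib]
  refine Finset.sum_congr rfl fun k _ ↦ ?_
  set X := stdOrthonormalBasis ℝ (TangentSpace (𝓡 n) x) k
  have hX : cov (m • σ) x X = m x • cov σ x X + mvfderiv (𝓡 n) m x X • σ x := by
    rw [cov.isCovariantDerivativeOnUniv.leibniz hσ hm]; rfl
  have hn : ‖(m • σ) x‖ ^ 2 = m x ^ 2 * ‖σ x‖ ^ 2 := by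
    rw [Pi.smul_apply', norm_smul, mul_pow, Real.norm_eq_abs, sq_abs]
  rw [hX, hn, mvfderiv_norm_sq hcov hσ, Pi.smul_apply']
  simp only [inner_add_left, inner_add_right, real_inner_smul_left, real_inner_smul_right]
  rw [real_inner_self_eq_norm_sq, real_inner_self_eq_norm_sq,
    real_inner_comm (cov σ x X) (σ x)]
  ring

end Sections

/-! ### Functions with vanishing differential -/

/-- A vanishing sum of squares kills `du` on a basis, hence everywhere; `u` is then locally constant
in charts, and constant by connectedness. -/
theorem eq_const_of_gradInner_self_eq_zero {n : ℕ} {M : Type*} [TopologicalSpace M]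
    [ConnectedSpace M] [ChartedSpace (EuclideanSpace ℝ (Fin n)) M] [IsManifold (𝓡 n) ∞ M]
    [RiemannianBundle (fun x : M ↦ TangentSpace (𝓡 n) x)] {u : M → ℝ}
    (hu : ContMDiff (𝓡 n) 𝓘(ℝ, ℝ) ∞ u) (h0 : ∀ x, gradInner n u u x = 0) : ∃ c, ∀ x, u x = c := by
  have hd : ∀ x, mvfderiv (𝓡 n) u x = 0 := by
    intro x
    have h1 := (Finset.sum_eq_zero_iff_of_nonneg fun k _ ↦ mul_self_nonneg _).1 (h0 x)
    have h2 : (mvfderiv (𝓡 n) u x).toLinearMap = 0 :=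
      (stdOrthonormalBasis ℝ (TangentSpace (𝓡 n) x)).toBasis.ext fun k ↦ by
        simpa using h1 k (Finset.mem_univ _)
    exact ContinuousLinearMap.coe_injective h2
  have hloc : IsLocallyConstant u := by
    rw [IsLocallyConstant.iff_eventually_eq]
    intro x
    set e := chartAt (EuclideanSpace ℝ (Fin n)) x
    have he : e ∈ IsManifold.maximalAtlas (𝓡 n) ∞ M := IsManifold.chart_mem_maximalAtlas x
    have hx : x ∈ e.source := mem_chart_source _ x
    have hopen := e.open_target.isOpen_inter_preimage_of_fderiv_eq_zero (𝕜 := ℝ)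
      ((contDiffOn_comp_symm hu he).differentiableOn (by simp)) (fun y hy ↦ by
        have := mfderiv_comp y (hu.mdifferentiable (by simp) (e.symm y))
          ((mdifferentiable_of_mem_maximalAtlas he).mdifferentiableAt_symm hy)
        rw [mfderiv_eq_fderiv] at this
        refine this.trans ?_
        have h3 : mfderiv (𝓡 n) 𝓘(ℝ, ℝ) u (e.symm y) = 0 := hd (e.symm y)
        rw [h3]
        exact ContinuousLinearMap.zero_comp _) {u x}
    filter_upwards [e.open_source.mem_nhds hx, (e.continuousAt hx).preimage_mem_nhds
      (hopen.mem_nhds ⟨e.map_source hx, by simp [e.left_inv hx]⟩)] with z hz hz'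
    simpa [e.left_inv hz] using hz'.2
  exact ⟨u (Classical.arbitrary M), fun x ↦ hloc.apply_eq_of_isPreconnected isPreconnected_univ
    (mem_univ _) (mem_univ _)⟩

/-! ### Variations by multiples of a section -/

/-- A function on the range of the chart `e`, viewed as a function on `M` supported in the domain
of `e`. -/
def chartExtend {n : ℕ} {M : Type*} [TopologicalSpace M]
    (e : OpenPartialHomeomorph M (EuclideanSpace ℝ (Fin n))) (g : EuclideanSpace ℝ (Fin n) → ℝ) :
    M → ℝ :=
  e.source.indicator (g ∘ e)

section Sections

variable {n : ℕ} {M : Type*} [TopologicalSpace M] [ChartedSpace (EuclideanSpace ℝ (Fin n)) M]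
  [IsManifold (𝓡 n) ∞ M] [RiemannianBundle (fun x : M ↦ TangentSpace (𝓡 n) x)]
  [IsContMDiffRiemannianBundle (𝓡 n) ∞ (EuclideanSpace ℝ (Fin n))
    (fun x : M ↦ TangentSpace (𝓡 n) x)]
  {V : Type*} [NormedAddCommGroup V] [NormedSpace ℝ V]
  {E : M → Type*} [TopologicalSpace (TotalSpace V E)] [∀ x, NormedAddCommGroup (E x)]
  [∀ x, InnerProductSpace ℝ (E x)] [FiberBundle V E] [VectorBundle ℝ V E]
  {cov : CovariantDerivative (𝓡 n) V E} {σ : Π x, E x}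
  {e : OpenPartialHomeomorph M (EuclideanSpace ℝ (Fin n))}
  {g : EuclideanSpace ℝ (Fin n) → ℝ}

theorem chartExtend_symm {y : EuclideanSpace ℝ (Fin n)} (hy : y ∈ e.target) :
    chartExtend e g (e.symm y) = g y := by
  rw [chartExtend, indicator_of_mem (e.map_target hy), Function.comp_apply, e.right_inv hy]

theorem chartExtend_of_notMem {x : M} (hx : x ∉ e.symm '' tsupport g) : chartExtend e g x = 0 := by
  rw [chartExtend, indicator_apply_eq_zero]
  intro hxs
  exact image_eq_zero_of_notMem_tsupport (f := g) fun h ↦ hx ⟨e x, h, e.left_inv hxs⟩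

theorem isCompact_symm_image (hc : HasCompactSupport g) (hs : tsupport g ⊆ e.target) :
    IsCompact (e.symm '' tsupport g) :=
  hc.isCompact.image_of_continuousOn (e.continuousOn_symm.mono hs)

/-- In a Hausdorff manifold the image of the compact support is closed, so the extension by zero
vanishes near every point outside the domain of `e`. -/
theorem contMDiff_chartExtend [T2Space M] (he : e ∈ IsManifold.maximalAtlas (𝓡 n) ∞ M)
    (hg : ContDiff ℝ ∞ g) (hc : HasCompactSupport g) (hs : tsupport g ⊆ e.target) :
    ContMDiff (𝓡 n) 𝓘(ℝ, ℝ) ∞ (chartExtend e g) := by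
  intro x
  by_cases hx : x ∈ e.source
  · refine (hg.contMDiff.contMDiffAt.comp x
      (contMDiffAt_of_mem_maximalAtlas he hx)).congr_of_eventuallyEq ?_
    filter_upwards [e.open_source.mem_nhds hx] with z hz using indicator_of_mem hz _
  · refine (contMDiffAt_const (c := (0 : ℝ))).congr_of_eventuallyEq ?_
    have hx' : x ∈ (e.symm '' tsupport g)ᶜ := by
      rintro ⟨y, hy, rfl⟩; exact hx (e.map_target (hs hy))
    filter_upwards [(isCompact_symm_image hc hs).isClosed.isOpen_compl.mem_nhds hx'] with z hz
      using chartExtend_of_notMem hz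

/-- Rescaling σ along itself is the only kind of variation used. Smoothness in (x, t) is read in a
trivialization, which is linear on fibres and so commutes with the scalar factor. -/
theorem isVariation_smul
    (hσ : ContMDiff (𝓡 n) ((𝓡 n).prod 𝓘(ℝ, V)) ∞ (fun x ↦ TotalSpace.mk' V x (σ x)))
    {f : M → ℝ} (hf : ContMDiff (𝓡 n) 𝓘(ℝ, ℝ) ∞ f) {K : Set M} (hK : ∀ x ∉ K, f x = 0) :
    IsVariation n V σ K fun t ↦ (fun x ↦ 1 + t * f x) • σ where
  smooth := by
    intro z
    rw [contMDiffAt_totalSpace]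
    refine ⟨contMDiffAt_fst, ?_⟩
    have h1 := ((contMDiffAt_totalSpace.1 (hσ z.1)).2).comp z
      (contMDiffAt_fst (I := 𝓡 n) (J := 𝓘(ℝ, ℝ)) (n := ∞))
    have h2 : ContMDiffAt ((𝓡 n).prod 𝓘(ℝ, ℝ)) 𝓘(ℝ, ℝ) ∞ (fun z : M × ℝ ↦ 1 + z.2 * f z.1) z :=
      contMDiffAt_const.add (contMDiffAt_snd.mul ((hf z.1).comp z contMDiffAt_fst))
    refine (h2.smul h1).congr_of_eventuallyEq ?_
    have hb := (trivializationAt V E z.1).open_baseSet.mem_nhds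
      (FiberBundle.mem_baseSet_trivializationAt' z.1)
    filter_upwards [continuousAt_fst.preimage_mem_nhds hb] with w hw
    exact ((trivializationAt V E z.1).linear ℝ hw).2 _ _
  zero := by ext x; simp
  eq_off t x hx := by simp [hK x hx]

end Sections

/-! ### The first variation of the energy density -/

/-- The energy density of `(1 + t g) σ`, in terms of `g`, `U = |σ|²`, `S = |∇σ|²`, `A = |dU|²`,
`B = ⟨dg, dU⟩` and `C = |dg|²`. -/
def scaledDensity (p q t g U S A B C : ℝ) : ℝ :=
  (1 / (1 + (1 + t * g) ^ 2 * U)) ^ p *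
    ((1 + t * g) ^ 2 * S + (1 + t * g) * (t * B) + t ^ 2 * C * U +
      q * (1 + t * g) ^ 2 * ((1 + t * g) ^ 2 / 4 * A + (1 + t * g) * U * (t * B) +
        U ^ 2 * (t ^ 2 * C)))

/-- The derivative of `scaledDensity` in `t`. -/
def scaledDensityDeriv (p q t g U S A B C : ℝ) : ℝ :=
  -(2 * (1 + t * g) * g * U) / (1 + (1 + t * g) ^ 2 * U) ^ 2 * p *
      (1 / (1 + (1 + t * g) ^ 2 * U)) ^ (p - 1) *
    ((1 + t * g) ^ 2 * S + (1 + t * g) * (t * B) + t ^ 2 * C * U +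
      q * (1 + t * g) ^ 2 * ((1 + t * g) ^ 2 / 4 * A + (1 + t * g) * U * (t * B) +
        U ^ 2 * (t ^ 2 * C))) +
  (1 / (1 + (1 + t * g) ^ 2 * U)) ^ p *
    (2 * (1 + t * g) * g * S + (g * t + (1 + t * g)) * B + 2 * t * C * U +
      q * ((1 + t * g) ^ 3 * g * A +
        U * B * (3 * (1 + t * g) ^ 2 * g * t + (1 + t * g) ^ 3) +
        U ^ 2 * C * (2 * (1 + t * g) * g * t ^ 2 + 2 * t * (1 + t * g) ^ 2)))

theorem hasDerivAt_scaledDensity (p q g S A B C t : ℝ) {U : ℝ} (hU : 0 ≤ U) :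
    HasDerivAt (fun t ↦ scaledDensity p q t g U S A B C)
      (scaledDensityDeriv p q t g U S A B C) t := by
  have ha : 0 < 1 + (1 + t * g) ^ 2 * U := by positivity
  have hm : HasDerivAt (fun t ↦ 1 + t * g) g t := by
    simpa using ((hasDerivAt_id t).mul_const g).const_add 1
  have hb : HasDerivAt (fun t ↦ 1 / (1 + (1 + t * g) ^ 2 * U))
      (-(2 * (1 + t * g) * g * U) / (1 + (1 + t * g) ^ 2 * U) ^ 2) t := by
    have := (((hm.pow 2).mul_const U).const_add 1).inv ha.ne'
    simpa [one_div] using! this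
  have hbp := hb.rpow_const (p := p) (Or.inl (one_div_pos.2 ha).ne')
  have hid := hasDerivAt_id t
  have hQ := ((((hm.pow 2).mul_const S).add (hm.mul (hid.mul_const B))).add
    (((hid.pow 2).mul_const C).mul_const U)).add (((hm.pow 2).const_mul q).mul
      (((((hm.pow 2).div_const 4).mul_const A).add ((hm.mul_const U).mul (hid.mul_const B))).add
        (((hid.pow 2).mul_const C).const_mul (U ^ 2))))
  refine (hbp.mul hQ).congr_deriv ?_
  rw [scaledDensityDeriv]
  simp only [Pi.mul_apply, Pi.add_apply, Pi.pow_apply, id]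
  congr 2
  norm_num
  ring

theorem continuousOn_scaledDensity {X : Type*} [TopologicalSpace X] {s : Set X}
    {t g U S A B C : X → ℝ} (p q : ℝ) (ht : ContinuousOn t s) (hg : ContinuousOn g s)
    (hU : ContinuousOn U s) (hS : ContinuousOn S s) (hA : ContinuousOn A s) (hB : ContinuousOn B s)
    (hC : ContinuousOn C s) (hU0 : ∀ x ∈ s, 0 ≤ U x) :
    ContinuousOn (fun x ↦ scaledDensity p q (t x) (g x) (U x) (S x) (A x) (B x) (C x)) s ∧
    ContinuousOn (fun x ↦ scaledDensityDeriv p q (t x) (g x) (U x) (S x) (A x) (B x) (C x)) s := by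
  have h0 : ∀ x ∈ s, 0 < 1 + (1 + t x * g x) ^ 2 * U x := fun x hx ↦ by
    have := hU0 x hx; positivity
  have hb : ContinuousOn (fun x ↦ 1 / (1 + (1 + t x * g x) ^ 2 * U x)) s :=
    continuousOn_const.div (by fun_prop) fun x hx ↦ (h0 x hx).ne'
  have hbp : ∀ r : ℝ, ContinuousOn (fun x ↦ (1 / (1 + (1 + t x * g x) ^ 2 * U x)) ^ r) s :=
    fun r ↦ hb.rpow_const fun x hx ↦ Or.inl (one_div_pos.2 (h0 x hx)).ne'
  have hb' : ContinuousOn (fun x ↦ -(2 * (1 + t x * g x) * g x * U x) /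
      (1 + (1 + t x * g x) ^ 2 * U x) ^ 2) s :=
    ContinuousOn.div (by fun_prop) (by fun_prop) fun x hx ↦ (pow_pos (h0 x hx) 2).ne'
  simp only [scaledDensity, scaledDensityDeriv]
  refine ⟨(hbp p).mul (by fun_prop), (((hb'.mul continuousOn_const).mul (hbp (p - 1))).mul
    (by fun_prop)).add ((hbp p).mul (by fun_prop))⟩

/-- The derivative at `t = 0`, up to the term that is the divergence of `g w^p (1 + q U) dU` when
`U` is harmonic. -/
theorem scaledDensityDeriv_zero (p q g S A B C : ℝ) {U : ℝ} (hU : 0 ≤ U) :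
    scaledDensityDeriv p q 0 g U S A B C =
      ((1 / (1 + U)) ^ p * (1 + q * U) * B +
        g * (-1 / (1 + U) ^ 2 * p * (1 / (1 + U)) ^ (p - 1) * (1 + q * U) +
          (1 / (1 + U)) ^ p * q) * A) +
      g * ((1 / (1 + U)) ^ (p + 1) *
        (2 * (1 + (1 - p) * U) * S + p * (1 + q * U / 2) * A)) := by
  have hU1 : 0 < 1 + U := by positivity
  have hw : 0 < 1 / (1 + U) := by positivity
  -- All real powers are reduced to the common exponent p + 1, after which the identity is rational
  -- in U.
  have e1 : (1 / (1 + U)) ^ p = (1 / (1 + U)) ^ (p + 1) * (1 + U) := by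
    rw [Real.rpow_add_one hw.ne']; field_simp
  have e2 : (1 / (1 + U)) ^ (p - 1) = (1 / (1 + U)) ^ (p + 1) * (1 + U) ^ 2 := by
    rw [Real.rpow_add_one hw.ne', Real.rpow_sub_one hw.ne']; field_simp
  simp only [scaledDensityDeriv, zero_mul, mul_zero, add_zero, one_pow, one_mul, mul_one]
  rw [e2, e1]
  field_simp
  ring

/-- For ψ(U) = (1 + U)^(-p) (1 + qU), this ψ' is the coefficient of g A in the first group of
`scaledDensityDeriv_zero`, which is therefore ⟨d(g ψ(U)), dU⟩. -/
theorem hasDerivAt_weight (p q : ℝ) {U : ℝ} (hU : 0 ≤ U) :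
    HasDerivAt (fun U ↦ (1 / (1 + U)) ^ p * (1 + q * U))
      (-1 / (1 + U) ^ 2 * p * (1 / (1 + U)) ^ (p - 1) * (1 + q * U) + (1 / (1 + U)) ^ p * q) U := by
  have hU1 : 0 < 1 + U := by positivity
  have hb : HasDerivAt (fun U : ℝ ↦ 1 / (1 + U)) (-1 / (1 + U) ^ 2) U := by
    simpa [one_div] using! ((hasDerivAt_id U).const_add 1).inv hU1.ne'
  have hl : HasDerivAt (fun U : ℝ ↦ 1 + q * U) q U := by
    simpa using ((hasDerivAt_id U).const_mul q).const_add 1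
  exact (hb.rpow_const (p := p) (Or.inl (one_div_pos.2 hU1).ne')).mul hl

/-! ### The pointwise equation -/

section Sections

variable {n : ℕ} {M : Type*} [TopologicalSpace M] [ChartedSpace (EuclideanSpace ℝ (Fin n)) M]
  [IsManifold (𝓡 n) ∞ M] [RiemannianBundle (fun x : M ↦ TangentSpace (𝓡 n) x)]
  [IsContMDiffRiemannianBundle (𝓡 n) ∞ (EuclideanSpace ℝ (Fin n))
    (fun x : M ↦ TangentSpace (𝓡 n) x)]
  {V : Type*} [NormedAddCommGroup V] [NormedSpace ℝ V]
  {E : M → Type*} [TopologicalSpace (TotalSpace V E)] [∀ x, NormedAddCommGroup (E x)]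
  [∀ x, InnerProductSpace ℝ (E x)] [FiberBundle V E] [VectorBundle ℝ V E]
  {cov : CovariantDerivative (𝓡 n) V E} {σ : Π x, E x}
  {e : OpenPartialHomeomorph M (EuclideanSpace ℝ (Fin n))}
  [ContMDiffVectorBundle ∞ V E (𝓡 n)] [IsContMDiffRiemannianBundle (𝓡 n) ∞ V E]
  [FiniteDimensional ℝ V]

theorem verticalNormSq_one_add_smul (hcov : cov.IsMetricCompatible)
    (hσ : ContMDiff (𝓡 n) ((𝓡 n).prod 𝓘(ℝ, V)) ∞ (fun x ↦ TotalSpace.mk' V x (σ x)))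
    {f : M → ℝ} (hf : ContMDiff (𝓡 n) 𝓘(ℝ, ℝ) ∞ f) (p q t : ℝ) (x : M) :
    verticalNormSq cov p q ((fun x ↦ 1 + t * f x) • σ) x =
      scaledDensity p q t (f x) (‖σ x‖ ^ 2) (covNormSq cov σ x)
        (gradInner n (fun x ↦ ‖σ x‖ ^ 2) (fun x ↦ ‖σ x‖ ^ 2) x)
        (gradInner n f (fun x ↦ ‖σ x‖ ^ 2) x) (gradInner n f f x) := by
  have hfx : MDifferentiableAt (𝓡 n) 𝓘(ℝ, ℝ) f x := hf.mdifferentiable (by simp) x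
  have hm : MDifferentiableAt (𝓡 n) 𝓘(ℝ, ℝ) (fun x ↦ 1 + t * f x) x :=
    (contMDiff_const.add (contMDiff_const.mul hf)).mdifferentiable (n := ∞) (by simp) x
  have hd : ∀ X, mvfderiv (𝓡 n) (fun x ↦ 1 + t * f x) x X = t * mvfderiv (𝓡 n) f x X := by
    intro X
    have hc : ∀ c : ℝ, MDifferentiableAt (𝓡 n) 𝓘(ℝ, ℝ) (fun _ : M ↦ c) x :=
      fun c ↦ mdifferentiableAt_const
    have htf : MDifferentiableAt (𝓡 n) 𝓘(ℝ, ℝ) (fun x ↦ t * f x) x :=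
      (contMDiff_const.mul hf).mdifferentiable (n := ∞) (by simp) x
    rw [mvfderiv_fun_add (hc 1) htf, mvfderiv_fun_mul (hc t) hfx, mvfderiv_const, mvfderiv_const]
    simp
  have h1 : ∀ h : M → ℝ, gradInner n (fun x ↦ 1 + t * f x) h x = t * gradInner n f h x := by
    intro h
    simp only [gradInner, hd, Finset.mul_sum, mul_assoc]
  have h2 : gradInner n (fun x ↦ 1 + t * f x) (fun x ↦ 1 + t * f x) x =
      t ^ 2 * gradInner n f f x := by
    simp only [gradInner, hd, Finset.mul_sum]
    exact Finset.sum_congr rfl fun k _ ↦ by ring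
  rw [verticalNormSq_smul hcov (hσ.mdifferentiable (by simp) x) hm, h1, h2, scaledDensity]
  ring

variable [T2Space M] [MeasurableSpace M] [BorelSpace M]

/-- The first variation formula, tested against `g` in the chart `e`. -/
theorem integral_scaledDensityDeriv_eq_zero
    [CovariantDerivative.ContMDiffCovariantDerivative cov ∞] (hcov : cov.IsMetricCompatible)
    (hσ : ContMDiff (𝓡 n) ((𝓡 n).prod 𝓘(ℝ, V)) ∞ (fun x ↦ TotalSpace.mk' V x (σ x))) {p q : ℝ}
    (h : IsHarmonicSection cov p q σ) (he : e ∈ IsManifold.maximalAtlas (𝓡 n) ∞ M)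
    {g : EuclideanSpace ℝ (Fin n) → ℝ} (hg : ContDiff ℝ ∞ g) (hc : HasCompactSupport g)
    (hs : tsupport g ⊆ e.target) :
    ∫ y in tsupport g, volumeDensity e y *
      scaledDensityDeriv p q 0 (g y) (‖σ (e.symm y)‖ ^ 2) (covNormSq cov σ (e.symm y))
        (gradInner n (fun x ↦ ‖σ x‖ ^ 2) (fun x ↦ ‖σ x‖ ^ 2) (e.symm y))
        (gradInner n (chartExtend e g) (fun x ↦ ‖σ x‖ ^ 2) (e.symm y))
        (gradInner n (chartExtend e g) (chartExtend e g) (e.symm y)) = 0 := by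
  have hu := contMDiff_norm_sq hσ
  have hf : ContMDiff (𝓡 n) 𝓘(ℝ, ℝ) ∞ (chartExtend e g) := contMDiff_chartExtend he hg hc hs
  set f := chartExtend e g with hfdef
  have hUc : ContinuousOn (fun y ↦ ‖σ (e.symm y)‖ ^ 2) (tsupport g) :=
    (contDiffOn_comp_symm hu he).continuousOn.mono hs
  have hSc : ContinuousOn (fun y ↦ covNormSq cov σ (e.symm y)) (tsupport g) :=
    (continuousOn_covNormSq_symm hσ he).mono hs
  have hAc := (continuousOn_gradInner_symm he hu hu).mono hs
  have hBc := (continuousOn_gradInner_symm he hf hu).mono hs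
  have hCc := (continuousOn_gradInner_symm he hf hf).mono hs
  have hdc : ContinuousOn (volumeDensity e) (tsupport g) :=
    (contDiffOn_volumeDensity he).continuousOn.mono hs
  have hFc : ∀ t, ContinuousOn (fun y ↦
      verticalNormSq cov p q ((fun x ↦ 1 + t * f x) • σ) (e.symm y)) (tsupport g) := by
    intro t
    refine (continuousOn_scaledDensity p q (t := fun _ ↦ t) continuousOn_const
      hg.continuous.continuousOn hUc hSc hAc hBc hCc fun y _ ↦ by positivity).1.congr fun y hy ↦ ?_
    simp only
    rw [verticalNormSq_one_add_smul hcov hσ hf, hfdef, chartExtend_symm (hs hy)]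
  have henergy : ∀ t, verticalEnergy cov p q (e.symm '' tsupport g)
      ((fun x ↦ 1 + t * f x) • σ) = 1 / 2 * ∫ y in tsupport g, volumeDensity e y *
        scaledDensity p q t (g y) (‖σ (e.symm y)‖ ^ 2) (covNormSq cov σ (e.symm y))
          (gradInner n (fun x ↦ ‖σ x‖ ^ 2) (fun x ↦ ‖σ x‖ ^ 2) (e.symm y))
          (gradInner n f (fun x ↦ ‖σ x‖ ^ 2) (e.symm y)) (gradInner n f f (e.symm y)) := by
    intro t
    rw [verticalEnergy, setIntegral_riemannianVolume he hc hs (hFc t)]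
    congr 1
    refine setIntegral_congr_fun hc.isCompact.isClosed.measurableSet fun y hy ↦ ?_
    rw [verticalNormSq_one_add_smul hcov hσ hf, hfdef, chartExtend_symm (hs hy)]
  have hvar := h _ (isCompact_symm_image hc hs) _ (isVariation_smul hσ hf
    fun x hx ↦ chartExtend_of_notMem hx)
  simp only [henergy] at hvar
  have hsnd : MapsTo Prod.snd ((univ : Set ℝ) ×ˢ tsupport g) (tsupport g) := fun z hz ↦ hz.2
  have hcont := continuousOn_scaledDensity p q (t := fun z : ℝ × EuclideanSpace ℝ (Fin n) ↦ z.1)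
    continuousOn_fst (hg.continuous.continuousOn.comp continuousOn_snd hsnd)
    (hUc.comp continuousOn_snd hsnd) (hSc.comp continuousOn_snd hsnd)
    (hAc.comp continuousOn_snd hsnd) (hBc.comp continuousOn_snd hsnd)
    (hCc.comp continuousOn_snd hsnd) fun z _ ↦ by simp only [Function.comp]; positivity
  have hderiv := (hasDerivAt_setIntegral_of_continuousOn (μ := volume) hc.isCompact
    (F := fun t y ↦ volumeDensity e y *
        scaledDensity p q t (g y) (‖σ (e.symm y)‖ ^ 2) (covNormSq cov σ (e.symm y))
          (gradInner n (fun x ↦ ‖σ x‖ ^ 2) (fun x ↦ ‖σ x‖ ^ 2) (e.symm y))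
          (gradInner n f (fun x ↦ ‖σ x‖ ^ 2) (e.symm y)) (gradInner n f f (e.symm y)))
    (fun t ↦ hdc.mul (continuousOn_scaledDensity p q (t := fun _ ↦ t) continuousOn_const
      hg.continuous.continuousOn hUc hSc hAc hBc hCc fun y _ ↦ by positivity).1)
    ((hdc.comp continuousOn_snd hsnd).mul hcont.2)
    (fun t y _ ↦ (hasDerivAt_scaledDensity p q _ _ _ _ _ t (by positivity)).const_mul _)
    0).const_mul (1 / 2)
  -- The derivative computed under the integral sign must agree with the zero derivative given by
  -- stationarity.
  have := hderiv.unique hvar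
  simpa using this

/-- If `σ` is `(p,q)`-harmonic and `|σ|²` is harmonic, then
`2 (1 + (1 - p) |σ|²) |∇σ|² + p (1 + q |σ|² / 2) |d|σ|²|² = 0`. -/
theorem IsHarmonicSection.pointwise_eq
    [CovariantDerivative.ContMDiffCovariantDerivative cov ∞] (hcov : cov.IsMetricCompatible)
    (hσ : ContMDiff (𝓡 n) ((𝓡 n).prod 𝓘(ℝ, V)) ∞ (fun x ↦ TotalSpace.mk' V x (σ x)))
    (hharm : IsHarmonicFunction n (fun x ↦ ‖σ x‖ ^ 2)) {p q : ℝ}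
    (h : IsHarmonicSection cov p q σ) (x : M) :
    2 * (1 + (1 - p) * ‖σ x‖ ^ 2) * covNormSq cov σ x + p * (1 + q * ‖σ x‖ ^ 2 / 2) *
      gradInner n (fun x ↦ ‖σ x‖ ^ 2) (fun x ↦ ‖σ x‖ ^ 2) x = 0 := by
  have hu := contMDiff_norm_sq hσ
  set e := chartAt (EuclideanSpace ℝ (Fin n)) x with hedef
  have he : e ∈ IsManifold.maximalAtlas (𝓡 n) ∞ M := IsManifold.chart_mem_maximalAtlas x
  set Φ : M → ℝ := fun x ↦ 2 * (1 + (1 - p) * ‖σ x‖ ^ 2) * covNormSq cov σ x +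
    p * (1 + q * ‖σ x‖ ^ 2 / 2) * gradInner n (fun x ↦ ‖σ x‖ ^ 2) (fun x ↦ ‖σ x‖ ^ 2) x with hΦ
  set U : EuclideanSpace ℝ (Fin n) → ℝ := fun y ↦ ‖σ (e.symm y)‖ ^ 2 with hU
  have hU0 : ∀ y, 0 ≤ U y := fun y ↦ by positivity
  have hUd : ContDiffOn ℝ ∞ U e.target := contDiffOn_comp_symm hu he
  have hSc : ContinuousOn (fun y ↦ covNormSq cov σ (e.symm y)) e.target :=
    continuousOn_covNormSq_symm hσ he
  have hAc := continuousOn_gradInner_symm he hu hu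
  have hU1 : ∀ y, 0 < 1 / (1 + U y) := fun y ↦ by have := hU0 y; positivity
  have hwd : ∀ r : ℝ, ContDiffOn ℝ ∞ (fun y ↦ (1 / (1 + U y)) ^ r) e.target := fun r ↦
    (contDiffOn_const.div (contDiffOn_const.add hUd) fun y _ ↦ by
      have := hU0 y; positivity).rpow_const_of_ne fun y _ ↦ (hU1 y).ne'
  -- What remains of the first variation as the factor of the test function, volume density
  -- included; the aim is R = 0 on the chart.
  set R : EuclideanSpace ℝ (Fin n) → ℝ := fun y ↦
    volumeDensity e y * ((1 / (1 + U y)) ^ (p + 1) * Φ (e.symm y)) with hR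
  have hΦc : ContinuousOn (fun y ↦ Φ (e.symm y)) e.target := by
    have := hUd.continuousOn
    simp only [hΦ]
    exact ((continuousOn_const.mul (continuousOn_const.add (continuousOn_const.mul this))).mul
      hSc).add ((continuousOn_const.mul (continuousOn_const.add
        ((continuousOn_const.mul this).div_const 2))).mul hAc)
  have hRc : ContinuousOn R e.target :=
    (contDiffOn_volumeDensity he).continuousOn.mul ((hwd (p + 1)).continuousOn.mul hΦc)
  have key : ∀ g : EuclideanSpace ℝ (Fin n) → ℝ, ContDiff ℝ ∞ g → HasCompactSupport g →
      tsupport g ⊆ e.target → ∫ y, g y • R y = 0 := by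
    intro g hg hc hs
    have hmeas : MeasurableSet (tsupport g) := hc.isCompact.isClosed.measurableSet
    have hf : ContMDiff (𝓡 n) 𝓘(ℝ, ℝ) ∞ (chartExtend e g) := contMDiff_chartExtend he hg hc hs
    have hfirst := integral_scaledDensityDeriv_eq_zero hcov hσ h he hg hc hs
    set ψ : ℝ → ℝ := fun U ↦ (1 / (1 + U)) ^ p * (1 + q * U) with hψ
    set ψ' : ℝ → ℝ := fun U ↦ -1 / (1 + U) ^ 2 * p * (1 / (1 + U)) ^ (p - 1) * (1 + q * U) +
      (1 / (1 + U)) ^ p * q with hψ'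
    -- The field √(det g) grad U in coordinates: harmonicity of U says exactly that its Euclidean
    -- divergence is zero.
    set W : Fin n → EuclideanSpace ℝ (Fin n) → ℝ := fun i z ↦ volumeDensity e z *
      ∑ j, (metricMatrix e z)⁻¹ i j * fderiv ℝ U z (EuclideanSpace.single j (1 : ℝ)) with hW
    have hdU : ∀ j : Fin n, ContDiffOn ℝ ∞
        (fun z ↦ fderiv ℝ U z (EuclideanSpace.single j (1 : ℝ))) e.target := fun j ↦
      (hUd.fderiv_of_isOpen e.open_target (by simp)).clm_apply contDiffOn_const
    have hWd : ∀ i, ContDiffOn ℝ ∞ (W i) e.target := fun i ↦ (contDiffOn_volumeDensity he).mul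
      (ContDiffOn.sum fun j _ ↦ (contDiffOn_inv_metricMatrix he i j).mul (hdU j))
    have hdiv : ∀ y ∈ e.target,
        ∑ i, fderiv ℝ (W i) y (EuclideanSpace.single i (1 : ℝ)) = 0 := by
      intro y hy
      have := hharm.2 e he y hy
      rw [laplacianInChart, neg_eq_zero, mul_eq_zero] at this
      exact this.resolve_left (inv_ne_zero (volumeDensity_pos he hy).ne')
    have hψU : ContDiffOn ℝ ∞ (fun y ↦ ψ (U y)) e.target :=
      (hwd p).mul (contDiffOn_const.add (contDiffOn_const.mul hUd))
    have hts : tsupport (fun y ↦ g y * ψ (U y)) ⊆ tsupport g := tsupport_mul_subset_left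
    -- ψ(U) is known to be smooth only on the target of `e`; off the support of `g` the product is
    -- locally zero.
    have hhd : ContDiff ℝ ∞ fun y ↦ g y * ψ (U y) := by
      rw [contDiff_iff_contDiffAt]
      intro y
      by_cases hy : y ∈ tsupport g
      · exact hg.contDiffAt.mul (hψU.contDiffAt (e.open_target.mem_nhds (hs hy)))
      · refine (contDiffAt_const (c := (0 : ℝ))).congr_of_eventuallyEq ?_
        filter_upwards [(isClosed_tsupport g).isOpen_compl.mem_nhds hy] with z hz
        rw [image_eq_zero_of_notMem_tsupport hz, zero_mul]
    have hdivint := integral_sum_fderiv_mul_eq_zero e.open_target hWd hdiv hhd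
      hc.mul_right (hts.trans hs)
    have hB : ∀ y ∈ e.target, volumeDensity e y *
        gradInner n (chartExtend e g) (fun x ↦ ‖σ x‖ ^ 2) (e.symm y) =
        ∑ i, fderiv ℝ g y (EuclideanSpace.single i (1 : ℝ)) * W i y := by
      intro y hy
      rw [gradInner_symm he hy (hf.mdifferentiable (by simp) _) (hu.mdifferentiable (by simp) _)]
      have hev : (fun z ↦ chartExtend e g (e.symm z)) =ᶠ[𝓝 y] g := by
        filter_upwards [e.open_target.mem_nhds hy] with z hz using chartExtend_symm hz
      rw [hev.fderiv_eq]
      simp only [hW, Finset.mul_sum]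
      exact Finset.sum_congr rfl fun i _ ↦ Finset.sum_congr rfl fun j _ ↦ by ring
    have hA : ∀ y ∈ e.target, volumeDensity e y *
        gradInner n (fun x ↦ ‖σ x‖ ^ 2) (fun x ↦ ‖σ x‖ ^ 2) (e.symm y) =
        ∑ i, fderiv ℝ U y (EuclideanSpace.single i (1 : ℝ)) * W i y := by
      intro y hy
      rw [gradInner_symm he hy (hu.mdifferentiable (by simp) _) (hu.mdifferentiable (by simp) _)]
      simp only [hW, Finset.mul_sum]
      exact Finset.sum_congr rfl fun i _ ↦ Finset.sum_congr rfl fun j _ ↦ by ring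
    have hterm : ∀ y ∈ tsupport g, ∑ i, fderiv ℝ (fun y ↦ g y * ψ (U y)) y
        (EuclideanSpace.single i (1 : ℝ)) * W i y = volumeDensity e y * (ψ (U y) *
          gradInner n (chartExtend e g) (fun x ↦ ‖σ x‖ ^ 2) (e.symm y) + g y * ψ' (U y) *
          gradInner n (fun x ↦ ‖σ x‖ ^ 2) (fun x ↦ ‖σ x‖ ^ 2) (e.symm y)) := by
      intro y hy
      have hUy : DifferentiableAt ℝ U y :=
        (hUd.differentiableOn (by simp)).differentiableAt (e.open_target.mem_nhds (hs hy))
      have hfd := ((hg.differentiable (by simp) y).hasFDerivAt.mul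
        ((hasDerivAt_weight p q (hU0 y)).comp_hasFDerivAt y hUy.hasFDerivAt)).fderiv
      have hfd' : fderiv ℝ (fun y ↦ g y * ψ (U y)) y =
        g y • ψ' (U y) • fderiv ℝ U y + ψ (U y) • fderiv ℝ g y := hfd
      rw [hfd', mul_add, mul_left_comm, hB y (hs hy), mul_left_comm, hA y (hs hy), Finset.mul_sum,
        Finset.mul_sum, ← Finset.sum_add_distrib]
      refine Finset.sum_congr rfl fun i _ ↦ ?_
      simp only [add_apply, smul_apply, smul_eq_mul]
      ring
    have hdivset : ∫ y in tsupport g, volumeDensity e y * (ψ (U y) *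
          gradInner n (chartExtend e g) (fun x ↦ ‖σ x‖ ^ 2) (e.symm y) + g y * ψ' (U y) *
          gradInner n (fun x ↦ ‖σ x‖ ^ 2) (fun x ↦ ‖σ x‖ ^ 2) (e.symm y)) = 0 := by
      rw [← setIntegral_congr_fun hmeas hterm,
        setIntegral_eq_integral_of_forall_compl_eq_zero, hdivint]
      · intro y hy
        refine Finset.sum_eq_zero fun i _ ↦ ?_
        rw [image_eq_zero_of_notMem_tsupport fun h' ↦ hy (hts (tsupport_fderiv_subset ℝ h'))]
        simp
    have hgR : IntegrableOn (fun y ↦ g y * R y) (tsupport g) :=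
      (hg.continuous.continuousOn.mul (hRc.mono hs)).integrableOn_compact hc
    have hdivc : IntegrableOn (fun y ↦ volumeDensity e y * (ψ (U y) *
          gradInner n (chartExtend e g) (fun x ↦ ‖σ x‖ ^ 2) (e.symm y) + g y * ψ' (U y) *
          gradInner n (fun x ↦ ‖σ x‖ ^ 2) (fun x ↦ ‖σ x‖ ^ 2) (e.symm y))) (tsupport g) := by
      refine ContinuousOn.integrableOn_compact hc ?_
      refine ContinuousOn.congr ?_ fun y hy ↦ (hterm y hy).symm
      exact continuousOn_finsetSum _ fun i _ ↦
        ((hhd.continuous_fderiv (by simp)).clm_apply continuous_const).continuousOn.mul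
          ((hWd i).continuousOn.mono hs)
    rw [← setIntegral_eq_integral_of_forall_compl_eq_zero (s := tsupport g) fun y hy ↦ by
      rw [image_eq_zero_of_notMem_tsupport hy, zero_smul]]
    have hsum := integral_add hdivc hgR
    rw [hdivset, zero_add] at hsum
    simp only [smul_eq_mul]
    rw [← hsum]
    refine (setIntegral_congr_fun hmeas fun y _ ↦ ?_).trans hfirst
    rw [scaledDensityDeriv_zero p q (U := ‖σ (e.symm y)‖ ^ 2) (hU := by positivity)]
    simp only [hR, hΦ, hψ, hψ', hU]
    ring
  -- The fundamental lemma of the calculus of variations; continuity then upgrades almost everywhere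
  -- to everywhere, and the positive factors of `R` are divided out.
  have hae : R =ᵐ[volume.restrict e.target] fun _ ↦ 0 :=
    (ae_restrict_iff' e.open_target.measurableSet).2
      (e.open_target.ae_eq_zero_of_integral_contDiff_smul_eq_zero
        (hRc.locallyIntegrableOn e.open_target.measurableSet) key)
  have hzero := Measure.eqOn_open_of_ae_eq hae e.open_target hRc continuousOn_const
    (mem_chart_target _ x)
  have hx : e.symm (e x) = x := e.left_inv (mem_chart_source _ x)
  simp only [hR, mul_eq_zero, (volumeDensity_pos he (mem_chart_target _ x)).ne', false_or,
    (Real.rpow_pos_of_pos (hU1 _) _).ne'] at hzero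
  rwa [hx] at hzero

end Sections

/-! ### Consequences of the pointwise equation -/

section Sections

variable {n : ℕ} {M : Type*} [TopologicalSpace M] [ChartedSpace (EuclideanSpace ℝ (Fin n)) M]
  [IsManifold (𝓡 n) ∞ M] [RiemannianBundle (fun x : M ↦ TangentSpace (𝓡 n) x)]
  [IsContMDiffRiemannianBundle (𝓡 n) ∞ (EuclideanSpace ℝ (Fin n))
    (fun x : M ↦ TangentSpace (𝓡 n) x)]
  {V : Type*} [NormedAddCommGroup V] [NormedSpace ℝ V]
  {E : M → Type*} [TopologicalSpace (TotalSpace V E)] [∀ x, NormedAddCommGroup (E x)]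
  [∀ x, InnerProductSpace ℝ (E x)] [FiberBundle V E] [VectorBundle ℝ V E]
  {cov : CovariantDerivative (𝓡 n) V E} {σ : Π x, E x}
  {e : OpenPartialHomeomorph M (EuclideanSpace ℝ (Fin n))}

theorem gradInner_self_nonneg (u : M → ℝ) (x : M) : 0 ≤ gradInner n u u x :=
  Finset.sum_nonneg fun _ _ ↦ mul_self_nonneg _

theorem gradInner_self_eq_zero_of_forall_le {u : M → ℝ} (hu : ContMDiff (𝓡 n) 𝓘(ℝ, ℝ) ∞ u) {x : M}
    (hx : ∀ z, u z ≤ u x) : gradInner n u u x = 0 := by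
  set e := chartAt (EuclideanSpace ℝ (Fin n)) x
  have he : e ∈ IsManifold.maximalAtlas (𝓡 n) ∞ M := IsManifold.chart_mem_maximalAtlas x
  have hex : e.symm (e x) = x := e.left_inv (mem_chart_source _ x)
  -- The maximum is global on `M`, so the values of `e.symm` outside the target are harmless.
  have hmax : IsLocalMax (fun y ↦ u (e.symm y)) (e x) :=
    Filter.Eventually.of_forall fun y ↦ by simpa only [hex] using hx (e.symm y)
  have := gradInner_symm he (mem_chart_target _ x) (hu.mdifferentiable (by simp) _)
    (hu.mdifferentiable (by simp) _)
  rw [hex] at this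
  rw [this, hmax.fderiv_eq_zero]
  simp

variable [ContMDiffVectorBundle ∞ V E (𝓡 n)] [IsContMDiffRiemannianBundle (𝓡 n) ∞ V E]
  [FiniteDimensional ℝ V]

/-- A non-constant |σ|² has non-zero differential somewhere; there A ≤ 4US with A > 0 forces the
other two quantities to be positive. -/
theorem exists_gradInner_norm_sq_pos [ConnectedSpace M] (hcov : cov.IsMetricCompatible)
    (hσ : ContMDiff (𝓡 n) ((𝓡 n).prod 𝓘(ℝ, V)) ∞ (fun x ↦ TotalSpace.mk' V x (σ x)))
    (hnonconst : ¬ ∃ c : ℝ, ∀ x, ‖σ x‖ ^ 2 = c) :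
    ∃ x, 0 < gradInner n (fun x ↦ ‖σ x‖ ^ 2) (fun x ↦ ‖σ x‖ ^ 2) x ∧ 0 < ‖σ x‖ ^ 2 ∧
      0 < covNormSq cov σ x := by
  obtain ⟨x, hx⟩ : ∃ x, gradInner n (fun x ↦ ‖σ x‖ ^ 2) (fun x ↦ ‖σ x‖ ^ 2) x ≠ 0 := by
    by_contra! h
    exact hnonconst (eq_const_of_gradInner_self_eq_zero (contMDiff_norm_sq hσ) h)
  have hA := (gradInner_self_nonneg (n := n) (fun x ↦ ‖σ x‖ ^ 2) x).lt_of_ne' hx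
  have hle := gradInner_norm_sq_self_le hcov (hσ.mdifferentiable (by simp) x)
  have hpos : 0 < ‖σ x‖ ^ 2 * covNormSq cov σ x := by nlinarith
  have hu : 0 < ‖σ x‖ ^ 2 := (sq_nonneg _).lt_of_ne fun h ↦ by simp [← h] at hpos
  exact ⟨x, hA, hu, (mul_pos_iff_of_pos_left hu).1 hpos⟩

end Sections

end HarmonicSections

end

/-! ### Uniqueness of `q` and the lower bounds for |σ|² -/

theorem corollary4p10
    {n : ℕ} {M : Type*} [TopologicalSpace M] [T2Space M] [SecondCountableTopology M]
    [ConnectedSpace M] [MeasurableSpace M] [BorelSpace M]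
    [ChartedSpace (EuclideanSpace ℝ (Fin n)) M] [IsManifold (𝓡 n) ∞ M]
    [RiemannianBundle (fun x : M ↦ TangentSpace (𝓡 n) x)]
    [IsContMDiffRiemannianBundle (𝓡 n) ∞ (EuclideanSpace ℝ (Fin n))
      (fun x : M ↦ TangentSpace (𝓡 n) x)]
    {V : Type*} [NormedAddCommGroup V] [NormedSpace ℝ V] [FiniteDimensional ℝ V]
    {E : M → Type*} [TopologicalSpace (TotalSpace V E)] [∀ x, NormedAddCommGroup (E x)]
    [∀ x, InnerProductSpace ℝ (E x)] [FiberBundle V E] [VectorBundle ℝ V E]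
    [ContMDiffVectorBundle ∞ V E (𝓡 n)]
    [IsContMDiffRiemannianBundle (𝓡 n) ∞ V E]
    (cov : CovariantDerivative (𝓡 n) V E) [CovariantDerivative.ContMDiffCovariantDerivative cov ∞]
    (hcov : cov.IsMetricCompatible)
    (σ : Π x, E x)
    (hσ : ContMDiff (𝓡 n) ((𝓡 n).prod 𝓘(ℝ, V)) ∞ (fun x ↦ TotalSpace.mk' V x (σ x)))
    (hharm : HarmonicSections.IsHarmonicFunction n (fun x ↦ ‖σ x‖ ^ 2))
    (hnonconst : ¬ ∃ c : ℝ, ∀ x, ‖σ x‖ ^ 2 = c) :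
    (∀ p q r : ℝ, HarmonicSections.IsHarmonicSection cov p q σ →
      HarmonicSections.IsHarmonicSection cov p r σ → q = r) ∧
    ∀ p q : ℝ, HarmonicSections.IsHarmonicSection cov p q σ →
      (p < 0 → q ≤ 4 * p → ∃ x, ‖σ x‖ ^ 2 > -2 / q) ∧
      (0 ≤ p → p ≤ 1 → q < 0 ∧ ∃ x, ‖σ x‖ ^ 2 > -2 / q) ∧
      (p > 1 → q < 2 * (1 - p) → ∃ x, ‖σ x‖ ^ 2 > -2 / q) ∧
      (p > 1 → q ≥ 2 * (1 - p) → ∃ x, ‖σ x‖ ^ 2 > 1 / (p - 1)) := by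
  open HarmonicSections in
  obtain ⟨x, hA, hu, hS⟩ := exists_gradInner_norm_sq_pos hcov hσ hnonconst
  have hle := gradInner_norm_sq_self_le hcov (hσ.mdifferentiable (by simp) x)
  refine ⟨fun p q r hq hr ↦ ?_, fun p q hq ↦ ?_⟩
  · have h1 := hq.pointwise_eq hcov hσ hharm x
    have h2 := hr.pointwise_eq hcov hσ hharm x
    set A := gradInner n (fun x ↦ ‖σ x‖ ^ 2) (fun x ↦ ‖σ x‖ ^ 2) x
    set S := covNormSq cov σ x
    set u := ‖σ x‖ ^ 2
    -- In the difference of the two equations only the terms linear in `q` and `r` survive.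
    have h3 : p * (q - r) * (u * A) = 0 := by linear_combination 2 * h1 - 2 * h2
    rcases mul_eq_zero.1 ((mul_eq_zero.1 h3).resolve_right (mul_pos hu hA).ne') with hp | hqr
    · subst hp
      have : 0 < (1 + u) * S := by positivity
      linarith
    · exact sub_eq_zero.1 hqr
  have heq := hq.pointwise_eq hcov hσ hharm x
  refine ⟨fun hp hqp ↦ ⟨x, ?_⟩, fun hp hp1 ↦ ?_, fun hp hqp ↦ ⟨x, ?_⟩, fun hp hqp ↦ ?_⟩
  · have hq0 : q < 0 := by linarith
    rw [gt_iff_lt, div_lt_iff_of_neg hq0]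
    generalize gradInner n (fun x ↦ ‖σ x‖ ^ 2) (fun x ↦ ‖σ x‖ ^ 2) x = A at *
    generalize covNormSq cov σ x = S at *
    generalize ‖σ x‖ ^ 2 = u at *
    by_contra! hcon
    -- The coefficient of A is nonpositive here, so A may be replaced by its upper bound 4uS; the
    -- left side of the equation is then at least 2S(1 + (1 + p)u + pqu²).
    have h1 : p * (1 + q * u / 2) * (4 * u * S) ≤ p * (1 + q * u / 2) * A :=
      mul_le_mul_of_nonpos_left hle (mul_nonpos_of_nonpos_of_nonneg hp.le (by nlinarith))
    have h2 : 0 < 1 + (1 + p) * u + p * q * u ^ 2 := by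
      have : 4 * p ^ 2 * u ^ 2 ≤ p * q * u ^ 2 :=
        mul_le_mul_of_nonneg_right (by nlinarith) (sq_nonneg u)
      -- From pq ≥ 4p², the expression is at least 1 + u + pu + 4p²u² = 15/16 + u + (4pu + 1/2)²/4.
      nlinarith [sq_nonneg (4 * p * u + 1 / 2)]
    nlinarith [mul_pos h2 hS]
  · have h1 : 0 < (1 + (1 - p) * ‖σ x‖ ^ 2) * covNormSq cov σ x := by
      have : 0 ≤ (1 - p) * ‖σ x‖ ^ 2 := mul_nonneg (by linarith) hu.le
      positivity
    -- The term in S is strictly positive for p ≤ 1, so the term in A has to be negative.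
    have h2 : q * ‖σ x‖ ^ 2 < -2 := by
      by_contra! hcon
      have := mul_nonneg (mul_nonneg hp (by linarith : 0 ≤ 1 + q * ‖σ x‖ ^ 2 / 2)) hA.le
      linarith
    have hq0 : q < 0 := by
      by_contra! hcon
      linarith [mul_nonneg hcon hu.le]
    exact ⟨hq0, x, by rw [gt_iff_lt, div_lt_iff_of_neg hq0]; linarith⟩
  · have hq0 : q < 0 := by linarith
    rw [gt_iff_lt, div_lt_iff_of_neg hq0]
    by_contra! hcon
    -- Since q < 2(1 - p), the assumption 1 + qu/2 ≥ 0 entails 1 + (1 - p)u > 0, and both terms of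
    -- the equation get the wrong sign.
    have h1 : q * ‖σ x‖ ^ 2 < 2 * (1 - p) * ‖σ x‖ ^ 2 := mul_lt_mul_of_pos_right hqp hu
    have h2 := mul_pos (by linarith : 0 < 1 + (1 - p) * ‖σ x‖ ^ 2) hS
    have h3 := mul_nonneg (mul_nonneg (by linarith : 0 ≤ p)
      (by linarith : 0 ≤ 1 + q * ‖σ x‖ ^ 2 / 2)) hA.le
    linarith
  · by_contra! hcon
    have hp1 : 0 < p - 1 := by linarith
    -- Strict inequality at `x` gives 1 + qu/2 ≥ 1 + (1 - p)u > 0, against the equation. Equality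
    -- makes `x` a global maximum of |σ|², where its differential vanishes, against the choice of
    -- `x`.
    rcases (hcon x).lt_or_eq with hlt | hmax
    · rw [lt_div_iff₀ hp1] at hlt
      have h1 : 2 * (1 - p) * ‖σ x‖ ^ 2 ≤ q * ‖σ x‖ ^ 2 := mul_le_mul_of_nonneg_right hqp hu.le
      have h2 := mul_pos (by linarith : 0 < 1 + (1 - p) * ‖σ x‖ ^ 2) hS
      have h3 := mul_nonneg (mul_nonneg (by linarith : 0 ≤ p)
        (by linarith : 0 ≤ 1 + q * ‖σ x‖ ^ 2 / 2)) hA.le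
      linarith
    · exact hA.ne' (gradInner_self_eq_zero_of_forall_le (contMDiff_norm_sq hσ)
        fun z ↦ (hcon z).trans hmax.ge)
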